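/- Let $\nu$ be a random variable with values in $\{1,2,3,\dots\}$ and finite mean $m=\mathbb{E}[\nu]>1$, and let $\xi$ be a nonnegative random variable. Let $\mathbb{T}$ be the Galton--Watson tree with root $\varnothing$ and offspring distribution the law of $\nu$, and, conditionally on $\mathbb{T}$, let $(\xi(e))_e$ be i.i.d. copies of $\xi$ indexed by the edges of $\mathbb{T}$. The depth $d(e)$ of an edge $e$ is the distance from the root to the farther endpoint of $e$, and the edge $e$ is given the resistance $r(e)=m^{d(e)}\xi(e)$. For $n\ge 1$ let $C_n$ be the effective conductance, in this electric network, between the root and the set of vertices at depth $n$; that is, $C_n=R_n^{-1}$, where $R_n=\inf_\theta\sum_e r(e)\theta(e)^2$, the infimum being over all flows $\theta$ of unit strength from the root to the set of vertices at depth $n$. Put $$a_1=m^{-2}\,\mathbb{E}[\nu(\nu-1)],\qquad a_2=m^{-3}\,\mathbb{E}\big[\nu(\nu-1)(\nu-2)\mathbf 1_{\{\nu\ge 2\}}\big],\qquad b_1=\mathbb{E}[\xi],\qquad b_2=\mathbb{E}[\xi^2],$$ $$c_1=\frac{a_1b_1}{1-m^{-1}},\qquad c_2=(1-m^{-2})^{-1}\Big(\frac{3a_1^2}{m-1}+a_2\Big),\qquad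 c_3=\frac{2a_1c_1}{m-1}-\frac{2b_1c_2}{m},$$ $$c_4=\frac{b_1}{1-m^{-1}}\Big(\frac{c_3}{c_1}+a_1\Big)-b_2\,\frac{c_2}{c_1}.$$ Assume that $\mathbb{E}[\xi^3+\xi^{-1}+\nu^4]<\infty$ (with $0^{-1}=\infty$). Then $\mathbb{E}[C_n]<\infty$ for every $n\ge 1$, and there exists a constant $c_0\in\mathbb{R}$ such that, as $n\to\infty$, $$\mathbb{E}[C_n]=\frac{1}{c_1 n}-\frac{c_4}{c_1^2}\,\frac{\log n}{n^2}-\frac{c_0}{c_1^2}\,\frac{1}{n^2}+O\Big(\frac{(\log n)^2}{n^3}\Big).$$ -/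

import Mathlib

open MeasureTheory ProbabilityTheory Filter Asymptotics
open scoped ENNReal NNReal

noncomputable section

namespace BranchingNetwork

/-! ### Electric networks: flows, effective resistance, effective conductance -/

section Network

variable {V : Type*}

/-- A flow on a graph: an antisymmetric real function on the directed edges, extended by `0` to
pairs of vertices that are not joined by an edge. -/
structure Flow (G : SimpleGraph V) where
  /-- The amount of flow along the directed edge from `x` to `y`. -/
  val : V → V → ℝ
  antisymm : ∀ x y, val x y = -val y x
  eq_zero_of_not_adj : ∀ x y, ¬ G.Adj x y → val x y = 0

variable {G : SimpleGraph V}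

/-- The divergence of a flow at a vertex (the graph is meant to be locally finite). -/
def Flow.div (θ : Flow G) (x : V) : ℝ := ∑ᶠ y ∈ G.neighborSet x, θ.val x y

/-- `θ` is a flow from `A` to `Z` of unit strength: it satisfies the node law outside `A ∪ Z`, and
both the amount leaving `A` and the amount entering `Z` are equal to one (the graph is meant to be
locally finite and the sets `A` and `Z` finite). -/
structure Flow.IsUnitFlow (θ : Flow G) (A Z : Set V) : Prop where
  node_law : ∀ x, x ∉ A ∪ Z → θ.div x = 0
  source : ∑ᶠ a ∈ A, ∑ᶠ y ∈ G.neighborSet a \ A, θ.val a y = 1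
  sink : ∑ᶠ z ∈ Z, ∑ᶠ y ∈ G.neighborSet z \ Z, θ.val y z = 1

/-- The square `θ(e)²` of a flow along an undirected edge. -/
def Flow.sq (θ : Flow G) : Sym2 V → ℝ≥0 :=
  Sym2.lift ⟨fun x y => Real.toNNReal (θ.val x y ^ 2), fun x y => by
    simp only [θ.antisymm x y, neg_sq]⟩

/-- The energy `∑ r(e) θ(e)²`, a sum over the undirected edges. -/
def Flow.energy (θ : Flow G) (r : Sym2 V → ℝ≥0) : ℝ≥0∞ :=
  ∑' e : G.edgeSet, ((r e * θ.sq e : ℝ≥0) : ℝ≥0∞)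

/-- The effective resistance between `A` and `Z`, by Thomson's principle: the least energy of a
flow of unit strength from `A` to `Z`. -/
def effectiveResistance (G : SimpleGraph V) (r : Sym2 V → ℝ≥0) (A Z : Set V) : ℝ≥0∞ :=
  ⨅ (θ : Flow G) (_ : θ.IsUnitFlow A Z), θ.energy r

/-- The effective conductance, the reciprocal of the effective resistance. -/
def effectiveConductance (G : SimpleGraph V) (r : Sym2 V → ℝ≥0) (A Z : Set V) : ℝ≥0∞ :=
  (effectiveResistance G r A Z)⁻¹

end Network

/-! ### Rooted trees of finite words, and their critically weighted resistances -/

/-- The tree in which the vertex `u` has the `k u` children `u ++ [i]`, `i < k u`; vertices are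
finite words, the root is the empty word and the depth of a vertex is the length of the word. -/
def tree (k : List ℕ → ℕ) : Set (List ℕ) :=
  {x | ∀ u i, (u ++ [i]) <+: x → i < k u}

/-- The edges of the tree join every non-root vertex of the tree to its parent. (Words that are not
vertices of the tree are isolated, hence play no role.) -/
def treeGraph (k : List ℕ → ℕ) : SimpleGraph (List ℕ) where
  Adj x y := x ∈ tree k ∧ y ∈ tree k ∧ ((∃ i, y = x ++ [i]) ∨ (∃ i, x = y ++ [i]))
  symm := ⟨fun _ _ h => ⟨h.2.1, h.1, h.2.2.symm⟩⟩
  loopless := ⟨fun x h => by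
    rcases h.2.2 with ⟨i, hi⟩ | ⟨i, hi⟩ <;> simpa using congrArg List.length hi⟩

/-- The vertices of the tree at depth `n`. -/
def level (k : List ℕ → ℕ) (n : ℕ) : Set (List ℕ) := {x | x ∈ tree k ∧ x.length = n}

/-- The edge joining the vertex `x` to its parent has resistance `m ^ |x| * s x`, where `|x|` is the
depth of that edge. (Pairs of words of equal length are not edges and get the value `0`.) -/
def resistance (m : ℝ≥0) (s : List ℕ → ℝ≥0) : Sym2 (List ℕ) → ℝ≥0 :=
  Sym2.lift ⟨fun x y =>
    if x.length < y.length then m ^ y.length * s y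
    else if y.length < x.length then m ^ x.length * s x
    else 0, fun x y => by
      rcases lt_trichotomy x.length y.length with h | h | h
      · simp [h, h.le]
      · simp [h]
      · simp [h, h.le]⟩

/-! ### The random network -/

section Random

variable {Ω : Type*} [MeasurableSpace Ω]

/-- The branching random network with offspring number distributed as `ν` and electric resistance
distributed as `ξ`: `N u` is the number of children of `u` and `Ξ x` is the variable attached to the
edge from `x` to its parent. All of these variables are independent. -/
structure IsBranchingNetwork (P : Measure Ω) (ν : Ω → ℕ) (ξ : Ω → ℝ≥0)
    (N : List ℕ → Ω → ℕ) (Ξ : List ℕ → Ω → ℝ≥0) : Prop where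
  measurable_offspring : ∀ u, Measurable (N u)
  measurable_edge : ∀ x, Measurable (Ξ x)
  identDistrib_offspring : ∀ u, IdentDistrib (N u) ν P P
  identDistrib_edge : ∀ x, IdentDistrib (Ξ x) ξ P P
  iIndepFun_offspring : iIndepFun N P
  iIndepFun_edge : iIndepFun Ξ P
  indepFun : IndepFun (fun ω u => N u ω) (fun ω x => Ξ x ω) P

/-- The mean offspring number `m = E[ν]`. -/
def mean (P : Measure Ω) (ν : Ω → ℕ) : ℝ≥0 :=
  ⟨∫ ω, (ν ω : ℝ) ∂P, integral_nonneg fun _ => Nat.cast_nonneg _⟩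

/-- The effective conductance `C_n` between the root and the vertices at depth `n`. -/
def conductance (m : ℝ≥0) (N : List ℕ → Ω → ℕ) (Ξ : List ℕ → Ω → ℝ≥0) (n : ℕ) (ω : Ω) : ℝ≥0∞ :=
  effectiveConductance (treeGraph fun u => N u ω) (resistance m fun x => Ξ x ω)
    {[]} (level (fun u => N u ω) n)

/-! ### The constants -/

def a₁ (P : Measure Ω) (ν : Ω → ℕ) : ℝ :=
  ((mean P ν : ℝ) ^ 2)⁻¹ * ∫ ω, (ν ω : ℝ) * ((ν ω : ℝ) - 1) ∂P

def a₂ (P : Measure Ω) (ν : Ω → ℕ) : ℝ :=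
  ((mean P ν : ℝ) ^ 3)⁻¹ *
    ∫ ω, (if 2 ≤ ν ω then (ν ω : ℝ) * ((ν ω : ℝ) - 1) * ((ν ω : ℝ) - 2) else 0) ∂P

def b₁ (P : Measure Ω) (ξ : Ω → ℝ≥0) : ℝ := ∫ ω, (ξ ω : ℝ) ∂P

def b₂ (P : Measure Ω) (ξ : Ω → ℝ≥0) : ℝ := ∫ ω, (ξ ω : ℝ) ^ 2 ∂P

def c₁ (P : Measure Ω) (ν : Ω → ℕ) (ξ : Ω → ℝ≥0) : ℝ :=
  a₁ P ν * b₁ P ξ / (1 - (mean P ν : ℝ)⁻¹)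

def c₂ (P : Measure Ω) (ν : Ω → ℕ) : ℝ :=
  (1 - ((mean P ν : ℝ) ^ 2)⁻¹)⁻¹ * (3 * a₁ P ν ^ 2 / ((mean P ν : ℝ) - 1) + a₂ P ν)

def c₃ (P : Measure Ω) (ν : Ω → ℕ) (ξ : Ω → ℝ≥0) : ℝ :=
  2 * a₁ P ν * c₁ P ν ξ / ((mean P ν : ℝ) - 1) - 2 * b₁ P ξ * c₂ P ν / (mean P ν : ℝ)

def c₄ (P : Measure Ω) (ν : Ω → ℕ) (ξ : Ω → ℝ≥0) : ℝ :=
  b₁ P ξ / (1 - (mean P ν : ℝ)⁻¹) * (c₃ P ν ξ / c₁ P ν ξ + a₁ P ν)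
    - b₂ P ξ * (c₂ P ν / c₁ P ν ξ)

end Random

end BranchingNetwork

end

open BranchingNetwork

/-! Write ρ = 1/m. Cutting the tree at its root gives the law C_{n+1} = ρ ∑_{i<ν} Y_i, where the Y_i
are independent copies of Y_n = (ξ + 1/C_n)⁻¹ and ξ is independent of C_n. Thomson's principle turns
the variational definition into this recursion (`effectiveConductance_eq_recCond`), almost surely,
because all offspring numbers and resistances are then positive.

Let x, y, z, w be the first four moments of C_n. Moments of random sums express them at time n+1
through the moments of Y_n: x' = E[Y], y' = ρ E[Y²] + a₁ x'², and so on. The alternating expansion Y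
= C - ξC² + ξ²C³ - …, with one-sided bounds after each term, gives x' = x - b₁ y + b₂ z + O(w), and
similarly for E[Y²] and E[Y³] (`momentRecursion`).

Two a priori bounds start the analysis. A convexity bound gives x ≤ E[1/ξ]/n
(`condMoment_one_le_div`). A comparison with a network started from a finite constant gives x ≥ δ/n
(`exists_div_le_condMoment`). The higher moments obey contractions with factors ρ, ρ², ρ³ forced by
lower moments, so y, z, w are O(n⁻²), O(n⁻³), O(n⁻⁴). Since x varies slowly, y and z follow x
adiabatically: z = βx³ + O(n⁻⁴) and y = αx² + γx³ + O(n⁻⁴), with α = a₁/(1-ρ), β = c₂, γ = c₃/(1-ρ).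

Hence x' = x - c₁x² - (b₁γ - b₂β)x³ + O(n⁻⁴), so that 1/x' - 1/x = c₁ + l x + O(n⁻²) with l = b₁γ -
b₂β + c₁² = c₁c₄ (`decayO_inv_succ_sub`). Summation gives 1/x = c₁n + c₄ log n + c₀ + O(log n / n),
and inversion gives the expansion (`exists_expansion_of_inv_increments`). -/

namespace BranchingNetwork

/-! ### Words and trees -/

section Words

variable {k : List ℕ → ℕ}

lemma nil_mem_tree : [] ∈ tree k := by
  intro u i h
  simp at h

lemma cons_mem_tree {i : ℕ} {x : List ℕ} :
    i :: x ∈ tree k ↔ i < k [] ∧ x ∈ tree fun u => k (i :: u) := by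
  constructor
  · intro h
    refine ⟨h [] i (by simp), fun u j hu => h (i :: u) j (by simpa using hu)⟩
  · rintro ⟨hi, hx⟩ u j hu
    cases u with
    | nil =>
      have : j = i := by simpa using hu
      exact this ▸ hi
    | cons a u =>
      rw [List.cons_append, List.cons_prefix_cons] at hu
      obtain ⟨rfl, hu⟩ := hu
      exact hx u j hu

lemma append_singleton_mem_tree {i : ℕ} {x : List ℕ} :
    x ++ [i] ∈ tree k ↔ x ∈ tree k ∧ i < k x := by
  constructor
  · intro h
    exact ⟨fun u j hu => h u j (hu.trans (List.prefix_append _ _)), h x i List.prefix_rfl⟩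
  · rintro ⟨hx, hi⟩ u j hu
    rw [List.prefix_concat_iff] at hu
    rcases hu with hu | hu
    · obtain ⟨rfl, hj⟩ := List.append_inj' hu rfl
      have : j = i := by simpa using hj
      exact this ▸ hi
    · exact hx u j hu

lemma dropLast_mem_tree {x : List ℕ} (hx : x ∈ tree k) : x.dropLast ∈ tree k :=
  fun u i h => hx u i (h.trans (List.dropLast_prefix x))

/-- The vertices at depth `n`, as a finite set. -/
def levelFinset : ℕ → (List ℕ → ℕ) → Finset (List ℕ)
  | 0, _ => {[]}
  | n + 1, k => (Finset.range (k [])).biUnion fun i =>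
      (levelFinset n fun u => k (i :: u)).image (i :: ·)

lemma mem_levelFinset (n : ℕ) (k : List ℕ → ℕ) (x : List ℕ) :
    x ∈ levelFinset n k ↔ x ∈ level k n := by
  induction n generalizing k x with
  | zero =>
    simp only [levelFinset, Finset.mem_singleton, level, Set.mem_ofPred_eq, List.length_eq_zero_iff]
    constructor
    · rintro rfl
      exact ⟨nil_mem_tree, rfl⟩
    · exact fun h => h.2
  | succ n ih =>
    cases x with
    | nil => simp [levelFinset, level]
    | cons i x => simp [levelFinset, level, ih, cons_mem_tree, and_assoc]

lemma coe_levelFinset (n : ℕ) (k : List ℕ → ℕ) : (levelFinset n k : Set (List ℕ)) = level k n := by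
  ext x
  exact mem_levelFinset n k x

lemma sum_levelFinset_succ (n : ℕ) (k : List ℕ → ℕ) (g : List ℕ → ℝ) :
    ∑ x ∈ levelFinset (n + 1) k, g x =
      ∑ i ∈ Finset.range (k []), ∑ x ∈ levelFinset n (fun u => k (i :: u)), g (i :: x) := by
  rw [levelFinset, Finset.sum_biUnion]
  · exact Finset.sum_congr rfl fun i _ => Finset.sum_image fun a _ b _ h => by simpa using h
  · intro i _ j _ hij
    simp only [Function.onFun, Finset.disjoint_left, Finset.mem_image]
    rintro _ ⟨a, _, rfl⟩ ⟨b, _, hb⟩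
    exact hij (by simpa using (List.cons.inj hb).1.symm)

end Words

/-! ### The recursion for the conductance -/

/-- The conductance to depth `n` of a network whose vertices at depth `n` are linked to the target
by an additional conductance `c * m ^ (-n)`. -/
noncomputable def recCond (m : ℝ≥0) (c : ℝ≥0∞) : ℕ → (List ℕ → ℕ) → (List ℕ → ℝ≥0) → ℝ≥0∞
  | 0, _, _ => c
  | n + 1, k, s => (m : ℝ≥0∞)⁻¹ * ∑ i ∈ Finset.range (k []),
      ((s [i] : ℝ≥0∞) +
        (recCond m c n (fun u => k (i :: u)) (fun u => s (i :: u)))⁻¹)⁻¹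

/-- The real-valued form of `recCond m ⊤`, in which `0⁻¹ = 0` plays the role of `⊤⁻¹ = 0`. -/
noncomputable def realCond (m : ℝ) : ℕ → (List ℕ → ℕ) → (List ℕ → ℝ) → ℝ
  | 0, _, _ => 0
  | n + 1, k, s => ∑ i ∈ Finset.range (k []),
      (m * (s [i] + (realCond m n (fun u => k (i :: u)) (fun u => s (i :: u)))⁻¹))⁻¹

/-- The energy, up to depth `n`, of the flow carrying `f x` along the edge from the parent of `x`
to `x`. -/
noncomputable def energyTo (m : ℝ) : ℕ → (List ℕ → ℕ) → (List ℕ → ℝ) → (List ℕ → ℝ) → ℝ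
  | 0, _, _, _ => 0
  | n + 1, k, s, f => ∑ i ∈ Finset.range (k []),
      m * (s [i] * f [i] ^ 2 +
        energyTo m n (fun u => k (i :: u)) (fun u => s (i :: u)) (fun u => f (i :: u)))

/-! ### Thomson's principle on a fixed tree, along real-valued flows. -/

section Real

variable {m : ℝ} (hm : 0 < m)
include hm

lemma realCond_nonneg (n : ℕ) (k : List ℕ → ℕ) (s : List ℕ → ℝ) (hs : ∀ u, 0 < s u) :
    0 ≤ realCond m n k s := by
  induction n generalizing k s with
  | zero => exact le_rfl
  | succ n ih =>
    refine Finset.sum_nonneg fun i _ => ?_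
    have := ih (fun u => k (i :: u)) (fun u => s (i :: u)) fun u => hs _
    have := (hs [i]).le
    positivity

lemma realCond_succ_pos (n : ℕ) (k : List ℕ → ℕ) (s : List ℕ → ℝ) (hk : ∀ u, 1 ≤ k u)
    (hs : ∀ u, 0 < s u) : 0 < realCond m (n + 1) k s := by
  refine Finset.sum_pos (fun i _ => ?_) ⟨0, Finset.mem_range.2 (hk [])⟩
  have := realCond_nonneg hm n (fun u => k (i :: u)) (fun u => s (i :: u)) fun u => hs _
  have := hs [i]
  positivity

lemma energyTo_nonneg (n : ℕ) (k : List ℕ → ℕ) (s f : List ℕ → ℝ) (hs : ∀ u, 0 < s u) :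
    0 ≤ energyTo m n k s f := by
  induction n generalizing k s f with
  | zero => exact le_rfl
  | succ n ih =>
    refine Finset.sum_nonneg fun i _ => ?_
    have := ih (fun u => k (i :: u)) (fun u => s (i :: u)) (fun u => f (i :: u)) fun u => hs _
    have := (hs [i]).le
    positivity

omit hm in
lemma energyTo_congr (n : ℕ) (k : List ℕ → ℕ) (s f g : List ℕ → ℝ)
    (h : ∀ x ∈ tree k, x ≠ [] → f x = g x) : energyTo m n k s f = energyTo m n k s g := by
  induction n generalizing k s f g with
  | zero => rfl
  | succ n ih =>
    refine Finset.sum_congr rfl fun i hi => ?_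
    have hi := Finset.mem_range.1 hi
    rw [h [i] (cons_mem_tree.2 ⟨hi, nil_mem_tree⟩) (by simp)]
    rw [ih _ _ (fun u => f (i :: u)) (fun u => g (i :: u))
      fun x hx _ => h _ (cons_mem_tree.2 ⟨hi, hx⟩) (by simp)]

omit hm in
lemma energyTo_const_mul (n : ℕ) (k : List ℕ → ℕ) (s f : List ℕ → ℝ) (a : ℝ) :
    energyTo m n k s (fun x => a * f x) = a ^ 2 * energyTo m n k s f := by
  induction n generalizing k s f with
  | zero => simp [energyTo]
  | succ n ih =>
    simp only [energyTo, Finset.mul_sum]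
    refine Finset.sum_congr rfl fun i _ => ?_
    rw [ih]
    ring

/-- The lower bound in Thomson's principle. -/
lemma sq_le_energyTo_mul_realCond (n : ℕ) (k : List ℕ → ℕ) (s f : List ℕ → ℝ)
    (hk : ∀ u, 1 ≤ k u) (hs : ∀ u, 0 < s u)
    (hf : ∀ x ∈ tree k, 1 ≤ x.length → x.length < n + 1 →
      f x = ∑ i ∈ Finset.range (k x), f (x ++ [i])) :
    (∑ i ∈ Finset.range (k []), f [i]) ^ 2 ≤
      energyTo m (n + 1) k s f * realCond m (n + 1) k s := by
  induction n generalizing k s f with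
  | zero =>
    refine Finset.sum_sq_le_sum_mul_sum_of_sq_le_mul _ (fun i _ => ?_) (fun i _ => ?_)
      fun i _ => ?_
    · have := (hs [i]).le
      simp only [energyTo]
      positivity
    · have := (hs [i]).le
      simp only [realCond]
      positivity
    · have := hs [i]
      simp only [energyTo, realCond]
      apply le_of_eq
      field_simp
      simp
  | succ n ih =>
    -- Cauchy–Schwarz over the branches at the root. In each branch the induction hypothesis bounds
    -- the energy below by `f [i] ^ 2 / R`, which is what the series law needs.
    refine Finset.sum_sq_le_sum_mul_sum_of_sq_le_mul _ (fun i _ => ?_) (fun i _ => ?_)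
      fun i hi => ?_
    · have := (hs [i]).le
      have := energyTo_nonneg hm (n + 1) (fun u => k (i :: u)) (fun u => s (i :: u))
        (fun u => f (i :: u)) fun u => hs _
      positivity
    · have := (hs [i]).le
      have := realCond_nonneg hm (n + 1) (fun u => k (i :: u)) (fun u => s (i :: u)) fun u => hs _
      positivity
    · have hi := Finset.mem_range.1 hi
      have h0 := hs [i]
      have h1 := realCond_succ_pos hm n (fun u => k (i :: u)) (fun u => s (i :: u))
        (fun u => hk _) fun u => hs _
      have h2 := ih (fun u => k (i :: u)) (fun u => s (i :: u)) (fun u => f (i :: u))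
        (fun u => hk _) (fun u => hs _) fun x hx h1 h2 =>
          hf (i :: x) (cons_mem_tree.2 ⟨hi, hx⟩) (by simp) (by simpa using h2)
      have h3 : f [i] = ∑ j ∈ Finset.range (k [i]), f (i :: [j]) :=
        hf [i] (cons_mem_tree.2 ⟨hi, nil_mem_tree⟩) (by simp) (by simp)
      rw [← h3] at h2
      set R := realCond m (n + 1) (fun u => k (i :: u)) (fun u => s (i :: u))
      set E := energyTo m (n + 1) (fun u => k (i :: u)) (fun u => s (i :: u))
        (fun u => f (i :: u))
      have h4 : f [i] ^ 2 * R⁻¹ ≤ E := by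
        rw [← div_eq_mul_inv, div_le_iff₀ h1]
        exact h2
      have h5 : 0 < m * (s [i] + R⁻¹) := by positivity
      rw [← div_eq_mul_inv, le_div_iff₀ h5]
      have : f [i] ^ 2 * (m * (s [i] + R⁻¹)) = m * (s [i] * f [i] ^ 2 + f [i] ^ 2 * R⁻¹) := by ring
      rw [this]
      gcongr

/-- The flow attaining the minimum in Thomson's principle. -/
lemma exists_flow_energyTo_eq (n : ℕ) (k : List ℕ → ℕ) (s : List ℕ → ℝ)
    (hk : ∀ u, 1 ≤ k u) (hs : ∀ u, 0 < s u) :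
    ∃ f : List ℕ → ℝ, (∀ x, n + 1 < x.length → f x = 0) ∧
      (∀ x ∈ tree k, 1 ≤ x.length → x.length < n + 1 →
        f x = ∑ i ∈ Finset.range (k x), f (x ++ [i])) ∧
      ∑ i ∈ Finset.range (k []), f [i] = 1 ∧ ∑ x ∈ levelFinset (n + 1) k, f x = 1 ∧
      energyTo m (n + 1) k s f = (realCond m (n + 1) k s)⁻¹ := by
  induction n generalizing k s with
  | zero =>
    have hA := realCond_succ_pos hm 0 k s hk hs
    have hsum : ∑ i ∈ Finset.range (k []), (m * s [i])⁻¹ / realCond m 1 k s = 1 := by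
      rw [← Finset.sum_div, div_eq_one_iff_eq hA.ne']
      simp [realCond]
    refine ⟨fun x => if x.length = 1 then (m * s x)⁻¹ / realCond m 1 k s else 0,
      fun x hx => if_neg (by omega), fun x _ h1 h2 => by omega, by simpa using hsum, ?_, ?_⟩
    · rw [sum_levelFinset_succ]
      simpa [levelFinset] using hsum
    · have : ∀ i ∈ Finset.range (k []), m * (s [i] * ((m * s [i])⁻¹ / realCond m 1 k s) ^ 2 + 0)
          = (realCond m 1 k s)⁻¹ * ((m * s [i])⁻¹ / realCond m 1 k s) := fun i _ => by
        have := hs [i]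
        field_simp
        ring
      simp only [energyTo, zero_add, List.length_singleton, if_true]
      rw [Finset.sum_congr rfl this, ← Finset.mul_sum, hsum, mul_one]
  | succ n ih =>
    -- The optimal flow sends through branch `i` the share `a i`, proportional to the conductance of
    -- that branch, and follows the optimal unit flow `g i` inside it.
    choose g hg0 hg1 hg2 hg3 hg4 using fun i : ℕ => ih (fun u => k (i :: u))
      (fun u => s (i :: u)) (fun u => hk _) (fun u => hs _)
    set A := realCond m (n + 1 + 1) k s with hAdef
    have hA : 0 < A := realCond_succ_pos hm (n + 1) k s hk hs
    set R : ℕ → ℝ := fun i => (realCond m (n + 1) (fun u => k (i :: u)) (fun u => s (i :: u)))⁻¹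
    have hR : ∀ i, 0 < R i := fun i =>
      inv_pos.2 (realCond_succ_pos hm n _ _ (fun u => hk _) (fun u => hs _))
    set a : ℕ → ℝ := fun i => (m * (s [i] + R i))⁻¹ / A
    have hsum : ∑ i ∈ Finset.range (k []), a i = 1 := by
      rw [← Finset.sum_div, div_eq_one_iff_eq hA.ne']
      rfl
    let f : List ℕ → ℝ
      | [] => 0
      | [i] => a i
      | i :: j :: x => a i * g i (j :: x)
    have hf : ∀ i x, x ≠ [] → f (i :: x) = a i * g i x := by
      intro i x hx
      cases x with
      | nil => exact absurd rfl hx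
      | cons j x => rfl
    refine ⟨f, ?_, ?_, hsum, ?_, ?_⟩
    · intro x hx
      match x with
      | [] => rfl
      | [i] => simp at hx
      | i :: j :: x =>
        rw [hf i (j :: x) (by simp), hg0 i (j :: x) (by simpa using hx), mul_zero]
    · intro x hx h1 h2
      match x with
      | [] => simp at h1
      | [i] =>
        change a i = ∑ j ∈ Finset.range (k [i]), a i * g i [j]
        rw [← Finset.mul_sum, hg2 i, mul_one]
      | i :: j :: x =>
        rw [hf i (j :: x) (by simp), hg1 i (j :: x) (cons_mem_tree.1 hx).2 (by simp) (by simpa using h2),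
          Finset.mul_sum]
        exact Finset.sum_congr rfl fun l _ => (hf _ _ (by simp)).symm
    · rw [sum_levelFinset_succ, ← hsum]
      refine Finset.sum_congr rfl fun i _ => ?_
      rw [← mul_one (a i), ← hg3 i, Finset.mul_sum]
      refine Finset.sum_congr rfl fun x hx => hf _ _ ?_
      rintro rfl
      have := ((mem_levelFinset _ _ _).1 hx).2
      simp at this
    -- Every branch has the same voltage drop `A⁻¹`, namely its share times its resistance, so it
    -- dissipates `A⁻¹ * a i`; the shares sum to one.
    · have : ∀ i ∈ Finset.range (k []), m * (s [i] * f [i] ^ 2 +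
          energyTo m (n + 1) (fun u => k (i :: u)) (fun u => s (i :: u)) (fun u => f (i :: u)))
          = A⁻¹ * a i := fun i _ => by
        rw [energyTo_congr _ _ _ _ (fun u => a i * g i u) fun x _ hx => hf i x hx,
          energyTo_const_mul, hg4]
        change m * (s [i] * a i ^ 2 + a i ^ 2 * R i) = A⁻¹ * a i
        have h1 : m * (s [i] * a i ^ 2 + a i ^ 2 * R i) = a i * (a i * (m * (s [i] + R i))) := by
          ring
        have h2 : 0 < m * (s [i] + R i) := mul_pos hm (add_pos (hs _) (hR _))
        rw [h1]
        have : a i * (m * (s [i] + R i)) = A⁻¹ := by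
          change (m * (s [i] + R i))⁻¹ / A * (m * (s [i] + R i)) = A⁻¹
          rw [div_mul_eq_mul_div, inv_mul_cancel₀ h2.ne', one_div]
        rw [this, mul_comm]
      rw [energyTo, Finset.sum_congr rfl this, ← Finset.mul_sum, hsum, mul_one]

end Real

/-- The starting values `0` and `⊤` both have inverse `0`, each in its own type. From level one on
the conductances are positive, and there the real and the extended inverse agree. -/
lemma ofReal_realCond {m : ℝ≥0} (hm : 0 < m) (n : ℕ) (k : List ℕ → ℕ) (s : List ℕ → ℝ≥0)
    (hk : ∀ u, 1 ≤ k u) (hs : ∀ u, 0 < s u) :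
    ENNReal.ofReal (realCond m (n + 1) k fun u => s u) = recCond m ⊤ (n + 1) k s := by
  induction n generalizing k s with
  | zero =>
    simp only [realCond, recCond, inv_zero, ENNReal.inv_top, add_zero]
    rw [ENNReal.ofReal_sum_of_nonneg fun i _ => by positivity, Finset.mul_sum]
    refine Finset.sum_congr rfl fun i _ => ?_
    have h1 := hs [i]
    rw [ENNReal.ofReal_inv_of_pos (by positivity), ENNReal.ofReal_mul (by positivity),
      ENNReal.ofReal_coe_nnreal, ENNReal.ofReal_coe_nnreal,
      ENNReal.mul_inv (by simp) (by simp)]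
  | succ n ih =>
    rw [realCond, recCond, ENNReal.ofReal_sum_of_nonneg, Finset.mul_sum]
    · refine Finset.sum_congr rfl fun i _ => ?_
      rw [← ih (fun u => k (i :: u)) (fun u => s (i :: u)) (fun u => hk _) fun u => hs _]
      have h1 := hs [i]
      have h2 := realCond_succ_pos (NNReal.coe_pos.2 hm) n (fun u => k (i :: u))
        (fun u => (s (i :: u) : ℝ)) (fun u => hk _) fun u => NNReal.coe_pos.2 (hs _)
      have h3 : (0 : ℝ) < s [i] := NNReal.coe_pos.2 h1
      rw [ENNReal.ofReal_inv_of_pos (by positivity), ENNReal.ofReal_mul (by positivity),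
        ENNReal.ofReal_add (by positivity) (by positivity), ENNReal.ofReal_coe_nnreal,
        ENNReal.ofReal_coe_nnreal, ENNReal.mul_inv (by simp) (by simp),
        ENNReal.ofReal_inv_of_pos h2]
    · intro i _
      have h2 := realCond_nonneg (NNReal.coe_pos.2 hm) (n + 1) (fun u => k (i :: u))
        (fun u => (s (i :: u) : ℝ)) fun u => NNReal.coe_pos.2 (hs _)
      positivity

/-! ### The effective conductance of a tree satisfies the recursion -/

/-! ### The energy as a sum over words, split by the first letter. -/

section Energy

open Classical in
/-- The energy of the edge from the parent of `x` to `x`, when it carries `f x`. -/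
noncomputable def edgeEnergy (m : ℝ≥0) (k : List ℕ → ℕ) (s : List ℕ → ℝ≥0) (f : List ℕ → ℝ)
    (x : List ℕ) : ℝ≥0∞ :=
  if x ∈ tree k ∧ x ≠ [] then ((m ^ x.length * s x * Real.toNNReal (f x ^ 2) : ℝ≥0) : ℝ≥0∞) else 0

variable {m : ℝ≥0} {k : List ℕ → ℕ} {s : List ℕ → ℝ≥0}

/-- The counterpart of the recursion of `energyTo` without truncation. The factor `m` arises because
an edge of a subtree is one level deeper in the whole tree. -/
lemma tsum_edgeEnergy (f : List ℕ → ℝ) :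
    ∑' x, edgeEnergy m k s f x = ∑ i ∈ Finset.range (k []),
      m * (s [i] * ENNReal.ofReal (f [i] ^ 2) + ∑' x, edgeEnergy m (fun u => k (i :: u))
        (fun u => s (i :: u)) (fun u => f (i :: u)) x) := by
  have hinj : Function.Injective fun p : ℕ × List ℕ => p.1 :: p.2 := by
    rintro ⟨i, x⟩ ⟨j, y⟩ h
    simpa using h
  rw [← hinj.tsum_eq, ENNReal.tsum_prod', tsum_eq_sum (s := Finset.range (k []))]
  · refine Finset.sum_congr rfl fun i hi => ?_
    have hi := Finset.mem_range.1 hi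
    have : ∀ x, edgeEnergy m k s f (i :: x) =
        (if x = [] then (m * (s [i] * ENNReal.ofReal (f [i] ^ 2)) : ℝ≥0∞) else 0) +
        m * edgeEnergy m (fun u => k (i :: u)) (fun u => s (i :: u)) (fun u => f (i :: u)) x := by
      intro x
      by_cases hx : x = []
      · subst hx
        simp [edgeEnergy, cons_mem_tree, hi, nil_mem_tree, ENNReal.ofReal, mul_assoc]
      · by_cases hx' : x ∈ tree fun u => k (i :: u)
        · simp [edgeEnergy, cons_mem_tree, hi, hx, hx', pow_succ]
          ring
        · simp [edgeEnergy, cons_mem_tree, hx, hx']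
    simp only [this]
    rw [ENNReal.tsum_add, tsum_ite_eq, ENNReal.tsum_mul_left, mul_add]
  · intro i hi
    have hi : ¬ i < k [] := by simpa using hi
    simp [edgeEnergy, cons_mem_tree, hi]
  · intro x hx
    cases x with
    | nil => simp [edgeEnergy] at hx
    | cons i x => exact ⟨(i, x), rfl⟩

lemma ofReal_energyTo_succ (hm : 0 < m) (hs : ∀ u, 0 < s u) (n : ℕ) (f : List ℕ → ℝ) :
    ENNReal.ofReal (energyTo m (n + 1) k (fun u => s u) f) = ∑ i ∈ Finset.range (k []),
      m * (s [i] * ENNReal.ofReal (f [i] ^ 2) + ENNReal.ofReal (energyTo m n (fun u => k (i :: u))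
        (fun u => s (i :: u)) (fun u => f (i :: u)))) := by
  have h : ∀ i, 0 ≤ energyTo (m : ℝ) n (fun u => k (i :: u))
        (fun u => (s (i :: u) : ℝ)) (fun u => f (i :: u)) := fun i =>
    energyTo_nonneg (NNReal.coe_pos.2 hm) _ _ _ _ fun u => NNReal.coe_pos.2 (hs _)
  rw [energyTo, ENNReal.ofReal_sum_of_nonneg]
  · refine Finset.sum_congr rfl fun i _ => ?_
    have := h i
    rw [ENNReal.ofReal_mul (by positivity), ENNReal.ofReal_add (by positivity) this,
      ENNReal.ofReal_mul (by positivity), ENNReal.ofReal_coe_nnreal, ENNReal.ofReal_coe_nnreal]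
  · intro i _
    have := h i
    positivity

/-- A competing flow may continue below the target level; discarding its energy there can only lower
the total. -/
lemma ofReal_energyTo_le (hm : 0 < m) (hs : ∀ u, 0 < s u) (n : ℕ) (f : List ℕ → ℝ) :
    ENNReal.ofReal (energyTo m n k (fun u => s u) f) ≤ ∑' x, edgeEnergy m k s f x := by
  induction n generalizing k s f with
  | zero => simp [energyTo]
  | succ n ih =>
    rw [ofReal_energyTo_succ hm hs, tsum_edgeEnergy]
    gcongr with i hi
    exact ih (fun u => hs _) _

lemma tsum_edgeEnergy_eq (hm : 0 < m) (hs : ∀ u, 0 < s u) (n : ℕ) (f : List ℕ → ℝ)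
    (hf : ∀ x, n < x.length → f x = 0) :
    ∑' x, edgeEnergy m k s f x = ENNReal.ofReal (energyTo m n k (fun u => s u) f) := by
  induction n generalizing k s f with
  | zero =>
    simp only [energyTo, ENNReal.ofReal_zero, ENNReal.tsum_eq_zero]
    intro x
    by_cases hx : x = []
    · simp [edgeEnergy, hx]
    · simp [edgeEnergy, hf x (List.length_pos_iff.2 hx)]
  | succ n ih =>
    rw [ofReal_energyTo_succ hm hs, tsum_edgeEnergy]
    refine Finset.sum_congr rfl fun i _ => ?_
    rw [ih (fun u => hs _) _ fun x hx => hf _ (by simpa using hx)]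

end Energy

/-! ### Flows on the graph of the tree as functions on non-root vertices. -/

section Graph

variable {k : List ℕ → ℕ}

lemma dropLast_adj {x : List ℕ} (hx : x ∈ tree k) (h : x ≠ []) :
    (treeGraph k).Adj x.dropLast x :=
  ⟨dropLast_mem_tree hx, hx, Or.inl ⟨x.getLast h, (List.dropLast_append_getLast h).symm⟩⟩

lemma adj_append {x : List ℕ} {i : ℕ} (hx : x ∈ tree k) (hi : i < k x) :
    (treeGraph k).Adj x (x ++ [i]) :=
  ⟨hx, append_singleton_mem_tree.2 ⟨hx, hi⟩, Or.inl ⟨i, rfl⟩⟩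

/-- The children of a vertex. -/
def children (k : List ℕ → ℕ) (x : List ℕ) : Finset (List ℕ) :=
  (Finset.range (k x)).image fun i => x ++ [i]

lemma sum_children (x : List ℕ) (g : List ℕ → ℝ) :
    ∑ y ∈ children k x, g y = ∑ i ∈ Finset.range (k x), g (x ++ [i]) :=
  Finset.sum_image fun a _ b _ h => by simpa using h

lemma neighborSet_nil : (treeGraph k).neighborSet [] = children k [] := by
  ext y
  simp only [SimpleGraph.mem_neighborSet, children, Finset.coe_image, Finset.coe_range,
    Set.mem_image, Set.mem_Iio]
  constructor
  · rintro ⟨_, hy, ⟨i, rfl⟩ | ⟨i, hi⟩⟩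
    · exact ⟨i, (append_singleton_mem_tree.1 hy).2, rfl⟩
    · simp at hi
  · rintro ⟨i, hi, rfl⟩
    exact adj_append nil_mem_tree hi

lemma neighborSet_of_ne_nil {x : List ℕ} (hx : x ∈ tree k) (h : x ≠ []) :
    (treeGraph k).neighborSet x = (insert x.dropLast (children k x) : Finset (List ℕ)) := by
  ext y
  simp only [SimpleGraph.mem_neighborSet, children, Finset.coe_insert, Finset.coe_image,
    Finset.coe_range, Set.mem_insert_iff, Set.mem_image, Set.mem_Iio]
  constructor
  · rintro ⟨_, hy, ⟨i, rfl⟩ | ⟨i, rfl⟩⟩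
    · exact Or.inr ⟨i, (append_singleton_mem_tree.1 hy).2, rfl⟩
    · exact Or.inl (by simp)
  · rintro (rfl | ⟨i, hi, rfl⟩)
    · exact (dropLast_adj hx h).symm
    · exact adj_append hx hi

lemma finsum_neighborSet_nil (g : List ℕ → ℝ) :
    ∑ᶠ y ∈ (treeGraph k).neighborSet [], g y = ∑ i ∈ Finset.range (k []), g [i] := by
  rw [neighborSet_nil, finsum_mem_coe_finset, sum_children]
  rfl

lemma finsum_neighborSet {x : List ℕ} (hx : x ∈ tree k) (h : x ≠ []) (g : List ℕ → ℝ) :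
    ∑ᶠ y ∈ (treeGraph k).neighborSet x, g y =
      g x.dropLast + ∑ i ∈ Finset.range (k x), g (x ++ [i]) := by
  rw [neighborSet_of_ne_nil hx h, finsum_mem_coe_finset, Finset.sum_insert, sum_children]
  simp only [children, Finset.mem_image, not_exists, not_and]
  intro i _ hi
  have := congrArg List.length hi
  simp at this
  omega

lemma finsum_neighborSet_of_notMem {x : List ℕ} (hx : x ∉ tree k) (g : List ℕ → ℝ) :
    ∑ᶠ y ∈ (treeGraph k).neighborSet x, g y = 0 := by
  have : (treeGraph k).neighborSet x = ∅ := by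
    ext y
    simp only [SimpleGraph.mem_neighborSet, Set.mem_empty_iff_false, iff_false]
    exact fun h => hx h.1
  rw [this]
  simp

/-- The edge joining a vertex to its parent. -/
def parentEdge (x : {x : List ℕ // x ∈ tree k ∧ x ≠ []}) : (treeGraph k).edgeSet :=
  ⟨s(x.1.dropLast, x.1), dropLast_adj x.2.1 x.2.2⟩

lemma parentEdge_bijective : Function.Bijective (parentEdge (k := k)) := by
  constructor
  · rintro ⟨x, hx⟩ ⟨y, hy⟩ h
    have h : s(x.dropLast, x) = s(y.dropLast, y) := congrArg Subtype.val h
    rw [Sym2.eq_iff] at h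
    rcases h with h | ⟨h1, h2⟩
    · exact Subtype.ext h.2
    · have hx' := List.length_pos_iff.2 hx.2
      have hy' := List.length_pos_iff.2 hy.2
      have h1 := congrArg List.length h1
      have h2 := congrArg List.length h2
      simp only [List.length_dropLast] at h1 h2
      omega
  · rintro ⟨e, he⟩
    induction e using Sym2.ind with
    | _ x y =>
      have hadj : (treeGraph k).Adj x y := he
      obtain ⟨hx, hy, ⟨i, rfl⟩ | ⟨i, rfl⟩⟩ := hadj
      · exact ⟨⟨x ++ [i], hy, by simp⟩, Subtype.ext (by simp [parentEdge])⟩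
      · exact ⟨⟨y ++ [i], hx, by simp⟩, Subtype.ext (by simp [parentEdge, Sym2.eq_swap])⟩

lemma resistance_parentEdge (m : ℝ≥0) (s : List ℕ → ℝ≥0) {x : List ℕ} (h : x ≠ []) :
    resistance m s s(x.dropLast, x) = m ^ x.length * s x := by
  have := List.length_pos_iff.2 h
  simp only [resistance, Sym2.lift_mk]
  rw [if_pos]
  simp only [List.length_dropLast]
  omega

/-- Edges correspond to non-root vertices through `parentEdge`; all other words contribute zero. -/
lemma energy_eq (m : ℝ≥0) (s : List ℕ → ℝ≥0) (θ : Flow (treeGraph k)) :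
    θ.energy (resistance m s) = ∑' x, edgeEnergy m k s (fun x => θ.val x.dropLast x) x := by
  rw [Flow.energy, ← (Equiv.ofBijective _ (parentEdge_bijective (k := k))).tsum_eq]
  have : ∀ x : {x : List ℕ // x ∈ tree k ∧ x ≠ []},
      ((resistance m s (parentEdge x) * θ.sq (parentEdge x) : ℝ≥0) : ℝ≥0∞) =
        edgeEnergy m k s (fun x => θ.val x.dropLast x) x := fun x => by
    rw [edgeEnergy, if_pos x.2, parentEdge, resistance_parentEdge m s x.2.2]
    rfl
  simp only [Equiv.ofBijective_apply, this]
  exact tsum_subtype_eq_of_support_subset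
    (s := {x : List ℕ | x ∈ tree k ∧ x ≠ []}) fun x hx => by
      by_contra h
      exact hx (if_neg h)

open Classical in
/-- The flow carrying `f x` along the edge from the parent of `x` to `x`. -/
noncomputable def flowOf (k : List ℕ → ℕ) (f : List ℕ → ℝ) : Flow (treeGraph k) where
  val x y := if (treeGraph k).Adj x y then (if x.length < y.length then f y else -f x) else 0
  antisymm x y := by
    by_cases h : (treeGraph k).Adj x y
    · rw [if_pos h, if_pos h.symm]
      obtain ⟨_, _, ⟨i, rfl⟩ | ⟨i, rfl⟩⟩ := h <;> simp
    · rw [if_neg h, if_neg fun h' => h h'.symm, neg_zero]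
  eq_zero_of_not_adj x y h := if_neg h

lemma flowOf_append {f : List ℕ → ℝ} {x : List ℕ} {i : ℕ} (hx : x ∈ tree k) (hi : i < k x) :
    (flowOf k f).val x (x ++ [i]) = f (x ++ [i]) := by
  simp [flowOf, adj_append hx hi]

lemma flowOf_dropLast {f : List ℕ → ℝ} {x : List ℕ} (hx : x ∈ tree k) (h : x ≠ []) :
    (flowOf k f).val x.dropLast x = f x := by
  have h' := List.length_pos_iff.2 h
  have : x.dropLast.length < x.length := by
    simp only [List.length_dropLast]
    omega
  simp only [flowOf, if_pos (dropLast_adj hx h), if_pos this]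

end Graph

/-! ### Matching lower and upper bounds for the effective resistance. -/

section Conductance

variable {m : ℝ≥0} {k : List ℕ → ℕ} {s : List ℕ → ℝ≥0}

/-- The values along parent edges satisfy the conservation law in `sq_le_energyTo_mul_realCond`, and
the source condition makes the left side of that inequality equal to one. -/
lemma le_energy_of_isUnitFlow (hm : 0 < m) (hk : ∀ u, 1 ≤ k u) (hs : ∀ u, 0 < s u) (n : ℕ)
    (θ : Flow (treeGraph k)) (hθ : θ.IsUnitFlow {[]} (level k (n + 1))) :
    (recCond m ⊤ (n + 1) k s)⁻¹ ≤ θ.energy (resistance m s) := by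
  set f : List ℕ → ℝ := fun x => θ.val x.dropLast x with hf
  have hsource : ∑ i ∈ Finset.range (k []), f [i] = 1 := by
    have h := hθ.source
    rw [finsum_mem_singleton] at h
    have hd : (treeGraph k).neighborSet [] \ {[]} = (treeGraph k).neighborSet [] := by
      rw [Set.sdiff_singleton_eq_self]
      exact fun h => (treeGraph k).loopless.irrefl _ h
    rw [hd, finsum_neighborSet_nil] at h
    exact h
  have hnode : ∀ x ∈ tree k, 1 ≤ x.length → x.length < n + 1 →
      f x = ∑ i ∈ Finset.range (k x), f (x ++ [i]) := by
    intro x hx h1 h2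
    have hne : x ≠ [] := List.length_pos_iff.1 h1
    have h := hθ.node_law x (by
      rintro (h | h)
      · exact hne h
      · exact absurd h.2 h2.ne)
    rw [Flow.div, finsum_neighborSet hx hne, θ.antisymm] at h
    simp only [hf, List.dropLast_concat]
    linarith
  have key := sq_le_energyTo_mul_realCond (NNReal.coe_pos.2 hm) n k (fun u => s u) f hk
    (fun u => NNReal.coe_pos.2 (hs u)) hnode
  have hpos := realCond_succ_pos (NNReal.coe_pos.2 hm) n k (fun u => s u) hk
    (fun u => NNReal.coe_pos.2 (hs u))
  rw [hsource, one_pow, ← div_le_iff₀ hpos, one_div] at key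
  rw [energy_eq, ← ofReal_realCond hm n k s hk hs, ← ENNReal.ofReal_inv_of_pos hpos]
  exact (ENNReal.ofReal_le_ofReal key).trans (ofReal_energyTo_le hm hs (n + 1) f)

lemma exists_isUnitFlow_energy_eq (hm : 0 < m) (hk : ∀ u, 1 ≤ k u) (hs : ∀ u, 0 < s u) (n : ℕ) :
    ∃ θ : Flow (treeGraph k), θ.IsUnitFlow {[]} (level k (n + 1)) ∧
      θ.energy (resistance m s) = (recCond m ⊤ (n + 1) k s)⁻¹ := by
  obtain ⟨f, hf0, hf1, hf2, hf3, hf4⟩ := exists_flow_energyTo_eq (NNReal.coe_pos.2 hm) n k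
    (fun u => s u) hk (fun u => NNReal.coe_pos.2 (hs u))
  have hpos := realCond_succ_pos (NNReal.coe_pos.2 hm) n k (fun u => s u) hk
    (fun u => NNReal.coe_pos.2 (hs u))
  have hchild : ∀ x ∈ tree k, ∑ i ∈ Finset.range (k x), (flowOf k f).val x (x ++ [i]) =
      ∑ i ∈ Finset.range (k x), f (x ++ [i]) := fun x hx =>
    Finset.sum_congr rfl fun i hi => flowOf_append hx (Finset.mem_range.1 hi)
  refine ⟨flowOf k f, ⟨?_, ?_, ?_⟩, ?_⟩
  · intro x hx
    rw [Flow.div]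
    by_cases hxt : x ∈ tree k
    · have hne : x ≠ [] := fun h => hx (Or.inl h)
      have hlen : x.length ≠ n + 1 := fun h => hx (Or.inr ⟨hxt, h⟩)
      rw [finsum_neighborSet hxt hne, Flow.antisymm, flowOf_dropLast hxt hne, hchild x hxt]
      rcases hlen.lt_or_gt with h | h
      · rw [← hf1 x hxt (List.length_pos_iff.2 hne) h]
        ring
      · rw [hf0 x h, Finset.sum_eq_zero fun i _ => hf0 _ (by simp; omega)]
        ring
    · exact finsum_neighborSet_of_notMem hxt _
  · rw [finsum_mem_singleton]
    have hd : (treeGraph k).neighborSet [] \ {[]} = (treeGraph k).neighborSet [] := by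
      rw [Set.sdiff_singleton_eq_self]
      exact fun h => (treeGraph k).loopless.irrefl _ h
    rw [hd, finsum_neighborSet_nil]
    exact (hchild [] nil_mem_tree).trans hf2
  · rw [← coe_levelFinset, finsum_mem_coe_finset, ← hf3]
    refine Finset.sum_congr rfl fun x hx => ?_
    have hx := (mem_levelFinset _ _ _).1 hx
    have hne : x ≠ [] := by
      rintro rfl
      exact absurd hx.2 (by simp)
    -- Adjacent words differ in length by one, so no neighbour of `x` lies on the same level.
    have hd : (treeGraph k).neighborSet x \ (levelFinset (n + 1) k : Set (List ℕ)) =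
        (treeGraph k).neighborSet x := by
      rw [coe_levelFinset, sdiff_eq_left, Set.disjoint_left]
      rintro y ⟨_, _, ⟨i, rfl⟩ | ⟨i, rfl⟩⟩ hy
      · have := hx.2
        have := hy.2
        simp at this
        omega
      · have := hx.2
        have := hy.2
        simp at *
        omega
    rw [hd, finsum_neighborSet hx.1 hne, flowOf_dropLast hx.1 hne, Finset.sum_eq_zero, add_zero]
    intro i hi
    rw [Flow.antisymm, flowOf_append hx.1 (Finset.mem_range.1 hi), hf0 _ (by simp [hx.2]), neg_zero]
  · rw [energy_eq, ← ofReal_realCond hm n k s hk hs, ← ENNReal.ofReal_inv_of_pos hpos, ← hf4,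
      ← tsum_edgeEnergy_eq hm hs (n + 1) f hf0]
    refine tsum_congr fun x => ?_
    by_cases h : x ∈ tree k ∧ x ≠ []
    · simp only [edgeEnergy, if_pos h, flowOf_dropLast h.1 h.2]
    · simp only [edgeEnergy, if_neg h]

lemma effectiveConductance_eq_recCond (hm : 0 < m) (hk : ∀ u, 1 ≤ k u) (hs : ∀ u, 0 < s u)
    (n : ℕ) : effectiveConductance (treeGraph k) (resistance m s) {[]} (level k (n + 1)) =
      recCond m ⊤ (n + 1) k s := by
  obtain ⟨θ, hθ, he⟩ := exists_isUnitFlow_energy_eq hm hk hs n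
  rw [effectiveConductance, effectiveResistance, ← inv_inv (recCond m ⊤ (n + 1) k s)]
  congr 1
  refine le_antisymm ?_ (le_iInf₂ fun θ hθ => le_energy_of_isUnitFlow hm hk hs n θ hθ)
  rw [← he]
  exact iInf₂_le θ hθ

end Conductance

/-! ### Moments of random sums -/

section RandomSum

variable {Ω : Type*} [MeasurableSpace Ω] {P : Measure Ω}

/-- Splitting over the values of `N` leaves one function `H k` at a time, so independence of `N`
from each `H k` separately suffices. -/
lemma lintegral_comp_of_indepFun {N : Ω → ℕ} (hN : Measurable N) {H : ℕ → Ω → ℝ≥0∞}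
    (hH : ∀ k, Measurable (H k)) (hind : ∀ k, IndepFun N (H k) P) :
    ∫⁻ ω, H (N ω) ω ∂P = ∫⁻ ω, (∫⁻ ω', H (N ω) ω' ∂P) ∂P := by
  have hmeas : ∀ k, Measurable fun n : ℕ => if n = k then (1 : ℝ≥0∞) else 0 := fun k =>
    measurable_from_nat
  have h1 : ∀ G : ℕ → Ω → ℝ≥0∞, ∀ ω, G (N ω) ω = ∑' k, (if N ω = k then 1 else 0) * G k ω := by
    intro G ω
    rw [tsum_eq_single (N ω)]
    · simp
    · intro k hk
      simp [hk.symm]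
  calc ∫⁻ ω, H (N ω) ω ∂P
      = ∑' k, ∫⁻ ω, (if N ω = k then 1 else 0) * H k ω ∂P := by
        simp_rw [h1 H]
        exact lintegral_tsum fun k => (((hmeas k).comp hN).mul (hH k)).aemeasurable
    _ = ∑' k, ∫⁻ ω, (if N ω = k then 1 else 0) * (∫⁻ ω', H k ω' ∂P) ∂P := by
        refine tsum_congr fun k => ?_
        have hk : Measurable fun ω => if N ω = k then (1 : ℝ≥0∞) else 0 := (hmeas k).comp hN
        rw [lintegral_mul_const _ hk]
        exact lintegral_mul_eq_lintegral_mul_lintegral_of_indepFun ((hmeas k).comp hN) (hH k)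
          ((hind k).comp (hmeas k) measurable_id)
    _ = ∫⁻ ω, (∫⁻ ω', H (N ω) ω' ∂P) ∂P := by
        simp_rw [h1 fun k _ => ∫⁻ ω', H k ω' ∂P]
        exact (lintegral_tsum fun k => (((hmeas k).comp hN).mul measurable_const).aemeasurable).symm

variable {Y : ℕ → Ω → ℝ≥0∞} {Q : ℕ → ℝ≥0∞}

/-- The data for moments of partial sums of i.i.d. variables: `Q j` is the moment of order `j`. -/
structure HasMoments (P : Measure Ω) (Y : ℕ → Ω → ℝ≥0∞) (Q : ℕ → ℝ≥0∞) : Prop where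
  measurable : ∀ i, Measurable (Y i)
  indepFun : ∀ k, IndepFun (fun ω => ∑ i ∈ Finset.range k, Y i ω) (Y k) P
  moment : ∀ i j, ∫⁻ ω, Y i ω ^ j ∂P = Q j

namespace HasMoments

variable (h : HasMoments P Y Q)
include h

lemma measurable_sum (k : ℕ) : Measurable fun ω => ∑ i ∈ Finset.range k, Y i ω :=
  Finset.measurable_fun_sum _ fun i _ => h.measurable i

lemma lintegral_sum_pow_mul (k a b : ℕ) :
    ∫⁻ ω, (∑ i ∈ Finset.range k, Y i ω) ^ a * Y k ω ^ b ∂P =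
      (∫⁻ ω, (∑ i ∈ Finset.range k, Y i ω) ^ a ∂P) * Q b := by
  rw [← h.moment k b]
  exact lintegral_mul_eq_lintegral_mul_lintegral_of_indepFun ((h.measurable_sum k).pow_const a)
    ((h.measurable k).pow_const b)
    ((h.indepFun k).comp (measurable_id.pow_const a) (measurable_id.pow_const b))

lemma lintegral_sum (k : ℕ) : ∫⁻ ω, ∑ i ∈ Finset.range k, Y i ω ∂P = k * Q 1 := by
  rw [lintegral_finsetSum _ fun i _ => h.measurable i]
  have : ∀ i, ∫⁻ ω, Y i ω ∂P = Q 1 := fun i => by simpa using h.moment i 1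
  simp [this]

/-- Induction on `k`: after expanding the power, each mixed moment factors, since `Y k` is
independent of the partial sum. Descending factorials count tuples of distinct indices, which is how
factorial moments of the offspring number arise later. -/
lemma lintegral_sum_sq (k : ℕ) : ∫⁻ ω, (∑ i ∈ Finset.range k, Y i ω) ^ 2 ∂P =
    k * Q 2 + (k.descFactorial 2 : ℝ≥0∞) * Q 1 ^ 2 := by
  induction k with
  | zero => simp
  | succ k ih =>
    have hY := h.measurable k
    have hS := h.measurable_sum k
    have e : ∀ ω, (∑ i ∈ Finset.range (k + 1), Y i ω) ^ 2 =
        (∑ i ∈ Finset.range k, Y i ω) ^ 2 +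
          (2 * ((∑ i ∈ Finset.range k, Y i ω) ^ 1 * Y k ω ^ 1) + Y k ω ^ 2) := by
      intro ω
      rw [Finset.sum_range_succ]
      ring
    simp_rw [e]
    rw [lintegral_add_left (by fun_prop), lintegral_add_left (by fun_prop),
      lintegral_const_mul _ (by fun_prop), h.lintegral_sum_pow_mul, ih, h.moment]
    simp only [pow_one]
    rw [h.lintegral_sum]
    have : (k + 1).descFactorial 2 = k.descFactorial 2 + 2 * k := by
      rcases k with _ | k
      · rfl
      · simp
        ring
    rw [this]
    push_cast
    ring

lemma lintegral_sum_cube (k : ℕ) : ∫⁻ ω, (∑ i ∈ Finset.range k, Y i ω) ^ 3 ∂P =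
    k * Q 3 + (k.descFactorial 2 : ℝ≥0∞) * (3 * (Q 2 * Q 1)) +
      (k.descFactorial 3 : ℝ≥0∞) * Q 1 ^ 3 := by
  induction k with
  | zero => simp
  | succ k ih =>
    have hY := h.measurable k
    have hS := h.measurable_sum k
    have e : ∀ ω, (∑ i ∈ Finset.range (k + 1), Y i ω) ^ 3 =
        (∑ i ∈ Finset.range k, Y i ω) ^ 3 +
          (3 * ((∑ i ∈ Finset.range k, Y i ω) ^ 2 * Y k ω ^ 1) +
          (3 * ((∑ i ∈ Finset.range k, Y i ω) ^ 1 * Y k ω ^ 2) + Y k ω ^ 3)) := by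
      intro ω
      rw [Finset.sum_range_succ]
      ring
    simp_rw [e]
    rw [lintegral_add_left (by fun_prop), lintegral_add_left (by fun_prop),
      lintegral_add_left (by fun_prop), lintegral_const_mul _ (by fun_prop),
      lintegral_const_mul _ (by fun_prop), h.lintegral_sum_pow_mul, h.lintegral_sum_pow_mul, ih,
      h.moment, h.lintegral_sum_sq]
    simp only [pow_one]
    rw [h.lintegral_sum]
    have h2 : (k + 1).descFactorial 2 = k.descFactorial 2 + 2 * k := by
      rcases k with _ | k
      · rfl
      · simp
        ring
    have h3 : (k + 1).descFactorial 3 = k.descFactorial 3 + 3 * k.descFactorial 2 := by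
      rcases k with _ | _ | k
      · rfl
      · rfl
      · simp
        ring
    rw [h2, h3]
    push_cast
    ring

/-- The coefficients 1, 4, 3, 6, 1 count the partitions of four factors into blocks of sizes 4, 3+1,
2+2, 2+1+1 and 1+1+1+1. -/
lemma lintegral_sum_pow_four (k : ℕ) : ∫⁻ ω, (∑ i ∈ Finset.range k, Y i ω) ^ 4 ∂P =
    k * Q 4 + (k.descFactorial 2 : ℝ≥0∞) * (4 * (Q 3 * Q 1) + 3 * Q 2 ^ 2) +
      (k.descFactorial 3 : ℝ≥0∞) * (6 * (Q 2 * Q 1 ^ 2)) +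
      (k.descFactorial 4 : ℝ≥0∞) * Q 1 ^ 4 := by
  induction k with
  | zero => simp
  | succ k ih =>
    have hY := h.measurable k
    have hS := h.measurable_sum k
    have e : ∀ ω, (∑ i ∈ Finset.range (k + 1), Y i ω) ^ 4 =
        (∑ i ∈ Finset.range k, Y i ω) ^ 4 +
          (4 * ((∑ i ∈ Finset.range k, Y i ω) ^ 3 * Y k ω ^ 1) +
          (6 * ((∑ i ∈ Finset.range k, Y i ω) ^ 2 * Y k ω ^ 2) +
          (4 * ((∑ i ∈ Finset.range k, Y i ω) ^ 1 * Y k ω ^ 3) + Y k ω ^ 4))) := by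
      intro ω
      rw [Finset.sum_range_succ]
      ring
    simp_rw [e]
    rw [lintegral_add_left (by fun_prop), lintegral_add_left (by fun_prop),
      lintegral_add_left (by fun_prop), lintegral_add_left (by fun_prop),
      lintegral_const_mul _ (by fun_prop), lintegral_const_mul _ (by fun_prop),
      lintegral_const_mul _ (by fun_prop), h.lintegral_sum_pow_mul, h.lintegral_sum_pow_mul,
      h.lintegral_sum_pow_mul, ih, h.moment, h.lintegral_sum_sq, h.lintegral_sum_cube]
    simp only [pow_one]
    rw [h.lintegral_sum]
    have h2 : (k + 1).descFactorial 2 = k.descFactorial 2 + 2 * k := by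
      rcases k with _ | k
      · rfl
      · simp
        ring
    have h3 : (k + 1).descFactorial 3 = k.descFactorial 3 + 3 * k.descFactorial 2 := by
      rcases k with _ | _ | k
      · rfl
      · rfl
      · simp
        ring
    have h4 : (k + 1).descFactorial 4 = k.descFactorial 4 + 4 * k.descFactorial 3 := by
      rcases k with _ | _ | _ | k
      · rfl
      · rfl
      · rfl
      · simp
        ring
    rw [h2, h3, h4]
    push_cast
    ring

lemma lintegral_randomSum_pow {N : Ω → ℕ} (hN : Measurable N)
    (hind : ∀ k, IndepFun N (fun ω => ∑ i ∈ Finset.range k, Y i ω) P) (j : ℕ) :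
    ∫⁻ ω, (∑ i ∈ Finset.range (N ω), Y i ω) ^ j ∂P =
      ∫⁻ ω, (∫⁻ ω', (∑ i ∈ Finset.range (N ω), Y i ω') ^ j ∂P) ∂P :=
  lintegral_comp_of_indepFun hN (fun k => (h.measurable_sum k).pow_const j)
    fun k => (hind k).comp measurable_id (measurable_id.pow_const j)

end HasMoments

end RandomSum

/-! ### Independence in a branching network -/

section Network

variable {Ω : Type*} [MeasurableSpace Ω] {P : Measure Ω} {ν : Ω → ℕ} {ξ : Ω → ℝ≥0}
  {N : List ℕ → Ω → ℕ} {Ξ : List ℕ → Ω → ℝ≥0}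

/-- The σ-algebras generated by the individual variables of the network. -/
def varAlgebra (N : List ℕ → Ω → ℕ) (Ξ : List ℕ → Ω → ℝ≥0) :
    List ℕ ⊕ List ℕ → MeasurableSpace Ω :=
  Sum.elim (fun u => MeasurableSpace.comap (N u) inferInstance)
    fun u => MeasurableSpace.comap (Ξ u) inferInstance

lemma varAlgebra_le (h : IsBranchingNetwork P ν ξ N Ξ) (j : List ℕ ⊕ List ℕ) :
    varAlgebra N Ξ j ≤ ‹MeasurableSpace Ω› := by
  rcases j with u | u
  · exact (h.measurable_offspring u).comap_le
  · exact (h.measurable_edge u).comap_le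

/-- Merging both families into one makes quantities built from disjoint sets of variables
independent in a single stroke (`indepFun_of_disjoint`). -/
lemma iIndep_varAlgebra (h : IsBranchingNetwork P ν ξ N Ξ) : iIndep (varAlgebra N Ξ) P := by
  rw [iIndep_iff]
  intro s f hf
  have hsplit : (⋂ j ∈ s, f j) =
      (⋂ u ∈ s.toLeft, f (Sum.inl u)) ∩ ⋂ u ∈ s.toRight, f (Sum.inr u) := by
    ext ω
    simp
  have hl : ∀ u ∈ s.toLeft, MeasurableSet[varAlgebra N Ξ (Sum.inl u)] (f (Sum.inl u)) :=
    fun u hu => hf _ (by simpa using hu)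
  have hr : ∀ u ∈ s.toRight, MeasurableSet[varAlgebra N Ξ (Sum.inr u)] (f (Sum.inr u)) :=
    fun u hu => hf _ (by simpa using hu)
  have hleN : ∀ u, varAlgebra N Ξ (Sum.inl u) ≤
      MeasurableSpace.comap (fun ω u => N u ω) inferInstance := fun u => by
    have h1 : Measurable[MeasurableSpace.comap (fun ω u => N u ω) inferInstance] (N u) :=
      (measurable_pi_apply u).comp (comap_measurable (fun ω u => N u ω))
    exact h1.comap_le
  have hleΞ : ∀ u, varAlgebra N Ξ (Sum.inr u) ≤
      MeasurableSpace.comap (fun ω u => Ξ u ω) inferInstance := fun u => by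
    have h1 : Measurable[MeasurableSpace.comap (fun ω u => Ξ u ω) inferInstance] (Ξ u) :=
      (measurable_pi_apply u).comp (comap_measurable (fun ω u => Ξ u ω))
    exact h1.comap_le
  rw [hsplit, h.indepFun.meas_inter, h.iIndepFun_offspring.meas_biInter hl,
    h.iIndepFun_edge.meas_biInter hr]
  · conv_rhs => rw [← Finset.toLeft_disjSum_toRight (u := s)]
    rw [Finset.prod_disjSum]
  · exact MeasurableSet.biInter s.toLeft.countable_toSet fun u hu => hleN u _ (hl u hu)
  · exact MeasurableSet.biInter s.toRight.countable_toSet fun u hu => hleΞ u _ (hr u hu)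

lemma indepFun_of_disjoint (h : IsBranchingNetwork P ν ξ N Ξ) {S T : Set (List ℕ ⊕ List ℕ)}
    (hST : Disjoint S T) {β γ : Type*} [MeasurableSpace β] [MeasurableSpace γ] {f : Ω → β}
    {g : Ω → γ} (hf : Measurable[⨆ j ∈ S, varAlgebra N Ξ j] f)
    (hg : Measurable[⨆ j ∈ T, varAlgebra N Ξ j] g) : IndepFun f g P := by
  rw [IndepFun_iff_Indep]
  have key := indep_iSup_of_disjoint (varAlgebra_le h) (iIndep_varAlgebra h) hST
  have key' := indep_of_indep_of_le_right key (measurable_iff_comap_le.1 hg)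
  exact indep_of_indep_of_le_left key' (measurable_iff_comap_le.1 hf)

lemma measurable_offspring_iSup {S : Set (List ℕ ⊕ List ℕ)} {u : List ℕ} (hu : Sum.inl u ∈ S) :
    Measurable[⨆ j ∈ S, varAlgebra N Ξ j] (N u) :=
  (comap_measurable (N u)).mono (le_iSup₂ (f := fun j _ => varAlgebra N Ξ j) _ hu) le_rfl

lemma measurable_edge_iSup {S : Set (List ℕ ⊕ List ℕ)} {u : List ℕ} (hu : Sum.inr u ∈ S) :
    Measurable[⨆ j ∈ S, varAlgebra N Ξ j] (Ξ u) :=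
  (comap_measurable (Ξ u)).mono (le_iSup₂ (f := fun j _ => varAlgebra N Ξ j) _ hu) le_rfl

lemma IsBranchingNetwork.shift (h : IsBranchingNetwork P ν ξ N Ξ) (i : ℕ) :
    IsBranchingNetwork P ν ξ (fun u => N (i :: u)) (fun u => Ξ (i :: u)) where
  measurable_offspring _ := h.measurable_offspring _
  measurable_edge _ := h.measurable_edge _
  identDistrib_offspring _ := h.identDistrib_offspring _
  identDistrib_edge _ := h.identDistrib_edge _
  iIndepFun_offspring := h.iIndepFun_offspring.precomp (g := (i :: ·)) (List.cons_injective)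
  iIndepFun_edge := h.iIndepFun_edge.precomp (g := (i :: ·)) (List.cons_injective)
  indepFun := h.indepFun.comp
    (measurable_pi_lambda (fun (k : List ℕ → ℕ) u => k (i :: u)) fun _ => measurable_pi_apply _)
    (measurable_pi_lambda (fun (s : List ℕ → ℝ≥0) u => s (i :: u)) fun _ => measurable_pi_apply _)

/-- The joint law is a product of infinite product measures, hence determined by the marginals.
Applied to `shift`, it says that the subtree at a child is distributed like the whole network. -/
lemma identDistrib_network (h : IsBranchingNetwork P ν ξ N Ξ)
    {N' : List ℕ → Ω → ℕ} {Ξ' : List ℕ → Ω → ℝ≥0} (h' : IsBranchingNetwork P ν ξ N' Ξ') :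
    IdentDistrib (fun ω => ((fun u => N u ω), fun u => Ξ u ω))
      (fun ω => ((fun u => N' u ω), fun u => Ξ' u ω)) P P := by
  have := h.iIndepFun_offspring.isProbabilityMeasure
  have hN := measurable_pi_lambda _ h.measurable_offspring
  have hΞ := measurable_pi_lambda _ h.measurable_edge
  have hN' := measurable_pi_lambda _ h'.measurable_offspring
  have hΞ' := measurable_pi_lambda _ h'.measurable_edge
  refine ⟨(hN.prodMk hΞ).aemeasurable, (hN'.prodMk hΞ').aemeasurable, ?_⟩
  rw [(indepFun_iff_map_prod_eq_prod_map_map hN.aemeasurable hΞ.aemeasurable).1 h.indepFun,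
    (indepFun_iff_map_prod_eq_prod_map_map hN'.aemeasurable hΞ'.aemeasurable).1 h'.indepFun,
    h.iIndepFun_offspring.map_fun_eq_infinitePi_map h.measurable_offspring,
    h.iIndepFun_edge.map_fun_eq_infinitePi_map h.measurable_edge,
    h'.iIndepFun_offspring.map_fun_eq_infinitePi_map h'.measurable_offspring,
    h'.iIndepFun_edge.map_fun_eq_infinitePi_map h'.measurable_edge]
  simp_rw [fun u => (h.identDistrib_offspring u).map_eq,
    fun u => (h'.identDistrib_offspring u).map_eq, fun u => (h.identDistrib_edge u).map_eq,
    fun u => (h'.identDistrib_edge u).map_eq]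

end Network

/-! ### The recursion for the moments of the conductance -/

/-- The conductance of a network in series with the edge leading to its root. -/
noncomputable def edgeCond (m : ℝ≥0) (c : ℝ≥0∞) (n : ℕ) (k : List ℕ → ℕ) (s : List ℕ → ℝ≥0) :
    ℝ≥0∞ :=
  ((s [] : ℝ≥0∞) + (recCond m c n k s)⁻¹)⁻¹

/-- The recursion never reads the edge variable at the root, hence the restriction `u ≠ []`; this
makes `Ξ []` independent of the conductance. The σ-algebra is left free so that the lemma also
applies to those generated by part of the variables. -/
lemma measurable_recCond {Ω : Type*} {_ : MeasurableSpace Ω} {N : List ℕ → Ω → ℕ}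
    {Ξ : List ℕ → Ω → ℝ≥0} (m : ℝ≥0) (c : ℝ≥0∞) (n : ℕ) (hN : ∀ u, Measurable (N u))
    (hΞ : ∀ u, u ≠ [] → Measurable (Ξ u)) :
    Measurable fun ω => recCond m c n (fun u => N u ω) (fun u => Ξ u ω) := by
  induction n generalizing N Ξ with
  | zero => exact measurable_const
  | succ n ih =>
    simp only [recCond]
    refine Measurable.const_mul ?_ _
    have hY : ∀ i, Measurable fun ω => ((Ξ [i] ω : ℝ≥0∞) +
        (recCond m c n (fun u => N (i :: u) ω) (fun u => Ξ (i :: u) ω))⁻¹)⁻¹ := fun i =>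
      (((hΞ [i] (by simp)).coe_nnreal_ennreal).add
        (ih (N := fun u => N (i :: u)) (Ξ := fun u => Ξ (i :: u)) (fun u => hN _)
          fun u _ => hΞ _ (by simp)).inv).inv
    -- The number of summands is random; joint measurability in that number and `ω` handles it, the
    -- former being discrete.
    have h : Measurable fun p : ℕ × Ω => ∑ i ∈ Finset.range p.1, ((Ξ [i] p.2 : ℝ≥0∞) +
        (recCond m c n (fun u => N (i :: u) p.2) (fun u => Ξ (i :: u) p.2))⁻¹)⁻¹ := by
      refine measurable_from_prod_countable_right fun k => ?_
      exact Finset.measurable_fun_sum (Finset.range k) fun i _ => hY i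
    have h' := h.comp ((hN []).prodMk measurable_id)
    exact h'

lemma measurable_edgeCond {Ω : Type*} {_ : MeasurableSpace Ω} {N : List ℕ → Ω → ℕ}
    {Ξ : List ℕ → Ω → ℝ≥0} (m : ℝ≥0) (c : ℝ≥0∞) (n : ℕ) (hN : ∀ u, Measurable (N u))
    (hΞ : ∀ u, Measurable (Ξ u)) :
    Measurable fun ω => edgeCond m c n (fun u => N u ω) (fun u => Ξ u ω) :=
  (((hΞ []).coe_nnreal_ennreal).add (measurable_recCond m c n hN fun u _ => hΞ u).inv).inv

section Moments

variable {Ω : Type*} [MeasurableSpace Ω] {P : Measure Ω} {ν : Ω → ℕ} {ξ : Ω → ℝ≥0}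
  {N : List ℕ → Ω → ℕ} {Ξ : List ℕ → Ω → ℝ≥0}

/-- The moment of order `j` of `recCond`. -/
noncomputable def condMoment (P : Measure Ω) (N : List ℕ → Ω → ℕ) (Ξ : List ℕ → Ω → ℝ≥0)
    (m : ℝ≥0) (c : ℝ≥0∞) (n j : ℕ) : ℝ≥0∞ :=
  ∫⁻ ω, recCond m c n (fun u => N u ω) (fun u => Ξ u ω) ^ j ∂P

/-- The moment of order `j` of `edgeCond`. -/
noncomputable def edgeMoment (P : Measure Ω) (N : List ℕ → Ω → ℕ) (Ξ : List ℕ → Ω → ℝ≥0)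
    (m : ℝ≥0) (c : ℝ≥0∞) (n j : ℕ) : ℝ≥0∞ :=
  ∫⁻ ω, edgeCond m c n (fun u => N u ω) (fun u => Ξ u ω) ^ j ∂P

lemma edgeMoment_shift (h : IsBranchingNetwork P ν ξ N Ξ) (m : ℝ≥0) (c : ℝ≥0∞) (n i j : ℕ) :
    edgeMoment P (fun u => N (i :: u)) (fun u => Ξ (i :: u)) m c n j =
      edgeMoment P N Ξ m c n j := by
  have hmeas : Measurable fun p : (List ℕ → ℕ) × (List ℕ → ℝ≥0) => edgeCond m c n p.1 p.2 ^ j := by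
    refine Measurable.pow_const ?_ j
    have h' := measurable_edgeCond m c n (N := fun u (p : (List ℕ → ℕ) × (List ℕ → ℝ≥0)) => p.1 u)
      (Ξ := fun u p => p.2 u) (fun u => (measurable_pi_apply u).comp measurable_fst)
      (fun u => (measurable_pi_apply u).comp measurable_snd)
    exact h'
  have key := ((identDistrib_network (h.shift i) h).comp hmeas).lintegral_eq
  exact key

lemma measurable_edgeCond_shift (m : ℝ≥0) (c : ℝ≥0∞) (n i : ℕ) {S : Set (List ℕ ⊕ List ℕ)}
    (hS : ∀ u, Sum.inl (i :: u) ∈ S ∧ Sum.inr (i :: u) ∈ S) :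
    Measurable[⨆ j ∈ S, varAlgebra N Ξ j] fun ω =>
      edgeCond m c n (fun u => N (i :: u) ω) (fun u => Ξ (i :: u) ω) :=
  measurable_edgeCond (N := fun u => N (i :: u)) (Ξ := fun u => Ξ (i :: u)) m c n
    (fun u => measurable_offspring_iSup (hS u).1) (fun u => measurable_edge_iSup (hS u).2)

/-- The variables attached to the words beginning with a letter less than `k`. -/
def headLT (k : ℕ) : Set (List ℕ ⊕ List ℕ) :=
  {j | ∃ i < k, ∃ u, j = Sum.inl (i :: u) ∨ j = Sum.inr (i :: u)}

/-- The variables attached to the words beginning with `k`. -/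
def headEQ (k : ℕ) : Set (List ℕ ⊕ List ℕ) :=
  {j | ∃ u, j = Sum.inl (k :: u) ∨ j = Sum.inr (k :: u)}

lemma measurable_sum_edgeCond_shift (m : ℝ≥0) (c : ℝ≥0∞) (n k : ℕ) :
    Measurable[⨆ j ∈ headLT k, varAlgebra N Ξ j] fun ω => ∑ i ∈ Finset.range k,
      edgeCond m c n (fun u => N (i :: u) ω) (fun u => Ξ (i :: u) ω) :=
  Finset.measurable_fun_sum _ fun i hi => measurable_edgeCond_shift m c n i fun u =>
    ⟨⟨i, Finset.mem_range.1 hi, u, Or.inl rfl⟩, ⟨i, Finset.mem_range.1 hi, u, Or.inr rfl⟩⟩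

lemma hasMoments_edgeCond (h : IsBranchingNetwork P ν ξ N Ξ) (m : ℝ≥0) (c : ℝ≥0∞) (n : ℕ) :
    HasMoments P (fun i ω => edgeCond m c n (fun u => N (i :: u) ω) (fun u => Ξ (i :: u) ω))
      (edgeMoment P N Ξ m c n) where
  measurable i := measurable_edgeCond (N := fun u => N (i :: u)) (Ξ := fun u => Ξ (i :: u)) m c n
    (fun u => h.measurable_offspring _) (fun u => h.measurable_edge _)
  indepFun k := by
    refine indepFun_of_disjoint h (S := headLT k) (T := headEQ k) ?_
      (measurable_sum_edgeCond_shift m c n k) (measurable_edgeCond_shift m c n k fun u =>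
        ⟨⟨u, Or.inl rfl⟩, ⟨u, Or.inr rfl⟩⟩)
    rw [Set.disjoint_left]
    rintro j ⟨i, hi, u, rfl | rfl⟩ ⟨v, hv | hv⟩ <;> simp at hv <;> omega
  moment i j := edgeMoment_shift h m c n i j

lemma indepFun_offspring_sum (h : IsBranchingNetwork P ν ξ N Ξ) (m : ℝ≥0) (c : ℝ≥0∞) (n k : ℕ) :
    IndepFun (N []) (fun ω => ∑ i ∈ Finset.range k,
      edgeCond m c n (fun u => N (i :: u) ω) (fun u => Ξ (i :: u) ω)) P := by
  refine indepFun_of_disjoint h (S := {Sum.inl []}) (T := headLT k) ?_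
    (measurable_offspring_iSup rfl) (measurable_sum_edgeCond_shift m c n k)
  rw [Set.disjoint_left]
  rintro j rfl ⟨i, hi, u, hu | hu⟩ <;> simp at hu

lemma indepFun_edge_recCond (h : IsBranchingNetwork P ν ξ N Ξ) (m : ℝ≥0) (c : ℝ≥0∞) (n : ℕ) :
    IndepFun (Ξ []) (fun ω => recCond m c n (fun u => N u ω) (fun u => Ξ u ω)) P := by
  refine indepFun_of_disjoint h (S := {Sum.inr []}) (T := {Sum.inr []}ᶜ) disjoint_compl_right
    (measurable_edge_iSup rfl) ?_
  refine measurable_recCond m c n (fun u => measurable_offspring_iSup ?_)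
    fun u hu => measurable_edge_iSup ?_
  · simp
  · simpa using hu

/-- The factorial moments of the offspring number. -/
noncomputable def factorialMoment (P : Measure Ω) (ν : Ω → ℕ) (j : ℕ) : ℝ≥0∞ :=
  ∫⁻ ω, ((ν ω).descFactorial j : ℝ≥0∞) ∂P

lemma factorialMoment_eq (h : IsBranchingNetwork P ν ξ N Ξ) (j : ℕ) :
    ∫⁻ ω, ((N [] ω).descFactorial j : ℝ≥0∞) ∂P = factorialMoment P ν j :=
  ((h.identDistrib_offspring []).comp
    (u := fun n : ℕ => (n.descFactorial j : ℝ≥0∞)) measurable_from_nat).lintegral_eq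

lemma condMoment_succ (h : IsBranchingNetwork P ν ξ N Ξ) {m : ℝ≥0} (hm : 0 < m) (c : ℝ≥0∞) (n j : ℕ) :
    condMoment P N Ξ m c (n + 1) j = (m : ℝ≥0∞)⁻¹ ^ j * ∫⁻ ω, (∫⁻ ω', (∑ i ∈
      Finset.range (N [] ω), edgeCond m c n (fun u => N (i :: u) ω') (fun u => Ξ (i :: u) ω')) ^ j
      ∂P) ∂P := by
  rw [← (hasMoments_edgeCond h m c n).lintegral_randomSum_pow (h.measurable_offspring [])
    (indepFun_offspring_sum h m c n), ← lintegral_const_mul']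
  · refine lintegral_congr fun ω => ?_
    rw [← mul_pow]
    rfl
  · exact ENNReal.pow_ne_top (ENNReal.inv_ne_top.2 (by simpa using hm.ne'))

end Moments

/-! ### Elementary inequalities for two conductances in series -/

section Pointwise

/-- This form also covers `c = 0`, and it reduces the inequalities below to polynomial identities.
-/
lemma series_eq (a c : ℝ≥0) :
    ((a : ℝ≥0∞) + (c : ℝ≥0∞)⁻¹)⁻¹ = ((c / (1 + a * c) : ℝ≥0) : ℝ≥0∞) := by
  rcases eq_or_ne c 0 with rfl | hc
  · simp
  · rw [← ENNReal.coe_inv hc, ← ENNReal.coe_add, ← ENNReal.coe_inv (by positivity)]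
    congr 1
    field_simp
    ring

lemma series_le_right (a C : ℝ≥0∞) : (a + C⁻¹)⁻¹ ≤ C := by
  rw [ENNReal.inv_le_iff_inv_le]
  exact le_add_self

lemma series_le_inv (a C : ℝ≥0∞) : (a + C⁻¹)⁻¹ ≤ a⁻¹ :=
  ENNReal.inv_le_inv.2 le_self_add

/-- Dirichlet's principle for two conductors in series, `l` and `l'` being the voltage drops: the
defect is a square. The bound is linear in `c` and `a⁻¹`, so it passes directly to expectations. -/
lemma series_le_tangent {a : ℝ≥0} (ha : a ≠ 0) (c l l' : ℝ≥0) (hl : l + l' = 1) :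
    ((a : ℝ≥0∞) + (c : ℝ≥0∞)⁻¹)⁻¹ ≤ l ^ 2 * c + l' ^ 2 * (a : ℝ≥0∞)⁻¹ := by
  rw [series_eq, ← ENNReal.coe_inv ha]
  norm_cast
  rw [← NNReal.coe_le_coe]
  push_cast
  have ha' : (0 : ℝ) < a := NNReal.coe_pos.2 (pos_iff_ne_zero.2 ha)
  have hc := c.coe_nonneg
  have h' : (l' : ℝ) = 1 - l := by
    have : (l : ℝ) + l' = 1 := by exact_mod_cast hl
    linarith
  rw [h', div_le_iff₀ (by positivity), ← sub_nonneg]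
  have : ((l : ℝ) ^ 2 * c + (1 - l) ^ 2 * (a : ℝ)⁻¹) * (1 + a * c) - c =
      (a : ℝ)⁻¹ * (l * (a * c + 1) - 1) ^ 2 := by
    field_simp
    ring
  rw [this]
  positivity

variable (a c : ℝ≥0)

/-- The partial sums of c/(1 + ac) = c - ac² + a²c³ - … bound it alternately from above and below.
Negative terms are moved across, as there is no useful subtraction in `ℝ≥0∞`. The lemmas that follow
treat the other truncations and the second and third powers. -/
lemma series_taylor_le : ((a : ℝ≥0∞) + (c : ℝ≥0∞)⁻¹)⁻¹ + a * c ^ 2 ≤ c + a ^ 2 * c ^ 3 := by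
  rw [series_eq]
  norm_cast
  rw [← NNReal.coe_le_coe]
  push_cast
  have ha := a.coe_nonneg
  have hc := c.coe_nonneg
  rw [← le_sub_iff_add_le, div_le_iff₀ (by positivity), ← sub_nonneg]
  have : ((c : ℝ) + a ^ 2 * c ^ 3 - a * c ^ 2) * (1 + a * c) - c = a ^ 3 * c ^ 4 := by ring
  rw [this]
  positivity

lemma le_series_taylor : (c : ℝ≥0∞) + a ^ 2 * c ^ 3 ≤
    ((a : ℝ≥0∞) + (c : ℝ≥0∞)⁻¹)⁻¹ + a * c ^ 2 + a ^ 3 * c ^ 4 := by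
  rw [series_eq]
  norm_cast
  rw [← NNReal.coe_le_coe]
  push_cast
  have ha := a.coe_nonneg
  have hc := c.coe_nonneg
  rw [add_assoc, ← sub_le_iff_le_add, le_div_iff₀ (by positivity), ← sub_nonneg]
  have : (c : ℝ) - (c + a ^ 2 * c ^ 3 - (a * c ^ 2 + a ^ 3 * c ^ 4)) * (1 + a * c) =
      a ^ 4 * c ^ 5 := by ring
  rw [this]
  positivity

lemma le_series_add : (c : ℝ≥0∞) ≤ ((a : ℝ≥0∞) + (c : ℝ≥0∞)⁻¹)⁻¹ + a * c ^ 2 := by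
  rw [series_eq]
  norm_cast
  rw [← NNReal.coe_le_coe]
  push_cast
  have ha := a.coe_nonneg
  have hc := c.coe_nonneg
  rw [← sub_le_iff_le_add, le_div_iff₀ (by positivity), ← sub_nonneg]
  have : (c : ℝ) - (c - a * c ^ 2) * (1 + a * c) = a ^ 2 * c ^ 3 := by ring
  rw [this]
  positivity

lemma series_sq_taylor_le : ((a : ℝ≥0∞) + (c : ℝ≥0∞)⁻¹)⁻¹ ^ 2 + 2 * (a * c ^ 3) ≤
    c ^ 2 + 3 * (a ^ 2 * c ^ 4) := by
  rw [series_eq]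
  norm_cast
  rw [← NNReal.coe_le_coe]
  push_cast
  have ha := a.coe_nonneg
  have hc := c.coe_nonneg
  rw [← le_sub_iff_add_le, div_pow, div_le_iff₀ (by positivity), ← sub_nonneg]
  have : ((c : ℝ) ^ 2 + 3 * (a ^ 2 * c ^ 4) - 2 * (a * c ^ 3)) * (1 + a * c) ^ 2 - c ^ 2 =
      4 * a ^ 3 * c ^ 5 + 3 * a ^ 4 * c ^ 6 := by ring
  rw [this]
  positivity

lemma le_series_sq_taylor : (c : ℝ≥0∞) ^ 2 ≤
    ((a : ℝ≥0∞) + (c : ℝ≥0∞)⁻¹)⁻¹ ^ 2 + 2 * (a * c ^ 3) := by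
  rw [series_eq]
  norm_cast
  rw [← NNReal.coe_le_coe]
  push_cast
  have ha := a.coe_nonneg
  have hc := c.coe_nonneg
  rw [← sub_le_iff_le_add, div_pow, le_div_iff₀ (by positivity), ← sub_nonneg]
  have : (c : ℝ) ^ 2 - (c ^ 2 - 2 * (a * c ^ 3)) * (1 + a * c) ^ 2 =
      3 * a ^ 2 * c ^ 4 + 2 * a ^ 3 * c ^ 5 := by ring
  rw [this]
  positivity

lemma le_series_cube_taylor : (c : ℝ≥0∞) ^ 3 ≤
    ((a : ℝ≥0∞) + (c : ℝ≥0∞)⁻¹)⁻¹ ^ 3 + 3 * (a * c ^ 4) := by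
  rw [series_eq]
  norm_cast
  rw [← NNReal.coe_le_coe]
  push_cast
  have ha := a.coe_nonneg
  have hc := c.coe_nonneg
  rw [← sub_le_iff_le_add, div_pow, le_div_iff₀ (by positivity), ← sub_nonneg]
  have : (c : ℝ) ^ 3 - (c ^ 3 - 3 * (a * c ^ 4)) * (1 + a * c) ^ 3 =
      6 * a ^ 2 * c ^ 5 + 8 * a ^ 3 * c ^ 6 + 3 * a ^ 4 * c ^ 7 := by ring
  rw [this]
  positivity

end Pointwise

lemma recCond_mono (m : ℝ≥0) {c c' : ℝ≥0∞} (hc : c ≤ c') (n : ℕ) (k : List ℕ → ℕ)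
    (s : List ℕ → ℝ≥0) : recCond m c n k s ≤ recCond m c' n k s := by
  induction n generalizing k s with
  | zero => exact hc
  | succ n ih =>
    simp only [recCond]
    gcongr
    exact ih _ _

/-! ### Inequalities between the moments -/

section Moments

variable {Ω : Type*} [MeasurableSpace Ω] {P : Measure Ω} {ν : Ω → ℕ} {ξ : Ω → ℝ≥0}
  {N : List ℕ → Ω → ℕ} {Ξ : List ℕ → Ω → ℝ≥0} {m : ℝ≥0} {c : ℝ≥0∞} {n : ℕ}

lemma measurable_recCond_network (h : IsBranchingNetwork P ν ξ N Ξ) (m : ℝ≥0) (c : ℝ≥0∞) (n : ℕ) :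
    Measurable fun ω => recCond m c n (fun u => N u ω) (fun u => Ξ u ω) :=
  measurable_recCond m c n h.measurable_offspring fun u _ => h.measurable_edge u

lemma measurable_edgeCond_network (h : IsBranchingNetwork P ν ξ N Ξ) (m : ℝ≥0) (c : ℝ≥0∞)
    (n : ℕ) : Measurable fun ω => edgeCond m c n (fun u => N u ω) (fun u => Ξ u ω) :=
  measurable_edgeCond m c n h.measurable_offspring h.measurable_edge

lemma edgeMoment_le_condMoment (j : ℕ) : edgeMoment P N Ξ m c n j ≤ condMoment P N Ξ m c n j :=
  lintegral_mono fun _ => pow_le_pow_left' (series_le_right _ _) j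

lemma lintegral_edge (h : IsBranchingNetwork P ν ξ N Ξ) {g : ℝ≥0 → ℝ≥0∞} (hg : Measurable g) :
    ∫⁻ ω, g (Ξ [] ω) ∂P = ∫⁻ ω, g (ξ ω) ∂P :=
  ((h.identDistrib_edge []).comp hg).lintegral_eq

lemma lintegral_edge_mul_recCond (h : IsBranchingNetwork P ν ξ N Ξ) {g : ℝ≥0 → ℝ≥0∞}
    (hg : Measurable g) (j : ℕ) :
    ∫⁻ ω, g (Ξ [] ω) * recCond m c n (fun u => N u ω) (fun u => Ξ u ω) ^ j ∂P =
      (∫⁻ ω, g (ξ ω) ∂P) * condMoment P N Ξ m c n j := by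
  rw [← lintegral_edge h hg]
  exact lintegral_mul_eq_lintegral_mul_lintegral_of_indepFun (hg.comp (h.measurable_edge []))
    ((measurable_recCond_network h m c n).pow_const j)
    ((indepFun_edge_recCond h m c n).comp hg (measurable_id.pow_const j))

/-- The moments of the edge variable. -/
noncomputable def xiMoment (P : Measure Ω) (ξ : Ω → ℝ≥0) (j : ℕ) : ℝ≥0∞ :=
  ∫⁻ ω, (ξ ω : ℝ≥0∞) ^ j ∂P

lemma lintegral_edge_pow_mul_recCond (h : IsBranchingNetwork P ν ξ N Ξ) (i j : ℕ) :
    ∫⁻ ω, (Ξ [] ω : ℝ≥0∞) ^ i * recCond m c n (fun u => N u ω) (fun u => Ξ u ω) ^ j ∂P =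
      xiMoment P ξ i * condMoment P N Ξ m c n j :=
  lintegral_edge_mul_recCond h (g := fun a : ℝ≥0 => (a : ℝ≥0∞) ^ i)
    (measurable_coe_nnreal_ennreal.pow_const i) j

lemma lintegral_edge_mul_recCond' (h : IsBranchingNetwork P ν ξ N Ξ) (j : ℕ) :
    ∫⁻ ω, (Ξ [] ω : ℝ≥0∞) * recCond m c n (fun u => N u ω) (fun u => Ξ u ω) ^ j ∂P =
      xiMoment P ξ 1 * condMoment P N Ξ m c n j := by
  simpa using lintegral_edge_pow_mul_recCond h (m := m) (c := c) (n := n) 1 j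

lemma lintegral_recCond : ∫⁻ ω, recCond m c n (fun u => N u ω) (fun u => Ξ u ω) ∂P =
    condMoment P N Ξ m c n 1 := by
  simp [condMoment]

lemma lintegral_edgeCond : ∫⁻ ω, edgeCond m c n (fun u => N u ω) (fun u => Ξ u ω) ∂P =
    edgeMoment P N Ξ m c n 1 := by
  simp [edgeMoment]

/-- One factor is bounded by the inverse edge variable and the other `j` by the conductance, which
is independent of it. So an edge in series gains one finite moment. -/
lemma edgeMoment_succ_le (h : IsBranchingNetwork P ν ξ N Ξ) (j : ℕ) :
    edgeMoment P N Ξ m c n (j + 1) ≤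
      (∫⁻ ω, (ξ ω : ℝ≥0∞)⁻¹ ∂P) * condMoment P N Ξ m c n j := by
  rw [← lintegral_edge_mul_recCond h (g := fun a : ℝ≥0 => (a : ℝ≥0∞)⁻¹)
    measurable_coe_nnreal_ennreal.inv j]
  refine lintegral_mono fun ω => ?_
  rw [pow_succ']
  exact mul_le_mul' (series_le_inv _ _) (pow_le_pow_left' (series_le_right _ _) j)

lemma ae_recCond_eq_coe (h : IsBranchingNetwork P ν ξ N Ξ)
    (hfin : condMoment P N Ξ m c n 1 ≠ ∞) :
    ∀ᵐ ω ∂P, ∃ x : ℝ≥0, recCond m c n (fun u => N u ω) (fun u => Ξ u ω) = x := by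
  rw [← lintegral_recCond] at hfin
  filter_upwards [ae_lt_top (measurable_recCond_network h m c n) hfin] with ω hω
  exact ⟨_, (ENNReal.coe_toNNReal hω.ne).symm⟩

variable (h : IsBranchingNetwork P ν ξ N Ξ) (hfin : condMoment P N Ξ m c n 1 ≠ ∞)
include h hfin

lemma edgeMoment_one_le_tangent (hξ : ∀ᵐ ω ∂P, ξ ω ≠ 0) (l l' : ℝ≥0) (hl : l + l' = 1) :
    edgeMoment P N Ξ m c n 1 ≤
      l ^ 2 * condMoment P N Ξ m c n 1 + l' ^ 2 * ∫⁻ ω, (ξ ω : ℝ≥0∞)⁻¹ ∂P := by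
  have hmeas : Measurable fun a : ℝ≥0 => (a : ℝ≥0∞)⁻¹ := measurable_coe_nnreal_ennreal.inv
  have hm1 := measurable_recCond_network h m c n
  have hΞ : ∀ᵐ ω ∂P, Ξ [] ω ≠ 0 :=
    (h.identDistrib_edge []).symm.ae_snd (p := fun a => a ≠ 0)
      (measurableSet_singleton (0 : ℝ≥0)).compl hξ
  have hE : Measurable fun ω => (Ξ [] ω : ℝ≥0∞)⁻¹ := hmeas.comp (h.measurable_edge [])
  rw [← lintegral_edge h hmeas, ← lintegral_recCond, ← lintegral_edgeCond,
    ← lintegral_const_mul _ hm1, ← lintegral_const_mul _ hE,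
    ← lintegral_add_left (hm1.const_mul _)]
  refine lintegral_mono_ae ?_
  filter_upwards [ae_recCond_eq_coe h hfin, hΞ] with ω ⟨x, hx⟩ h0
  rw [edgeCond, hx]
  exact series_le_tangent h0 x l l' hl

lemma edgeMoment_one_add_le : edgeMoment P N Ξ m c n 1 + xiMoment P ξ 1 * condMoment P N Ξ m c n 2 ≤
    condMoment P N Ξ m c n 1 + xiMoment P ξ 2 * condMoment P N Ξ m c n 3 := by
  rw [← lintegral_edge_mul_recCond' h, ← lintegral_edge_pow_mul_recCond h, ← lintegral_recCond,
    ← lintegral_edgeCond, ← lintegral_add_left (measurable_edgeCond_network h m c n),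
    ← lintegral_add_left (measurable_recCond_network h m c n)]
  refine lintegral_mono_ae ?_
  filter_upwards [ae_recCond_eq_coe h hfin] with ω ⟨x, hx⟩
  rw [edgeCond, hx]
  exact series_taylor_le _ _

lemma le_edgeMoment_one_add : condMoment P N Ξ m c n 1 + xiMoment P ξ 2 * condMoment P N Ξ m c n 3 ≤
    edgeMoment P N Ξ m c n 1 + xiMoment P ξ 1 * condMoment P N Ξ m c n 2 +
      xiMoment P ξ 3 * condMoment P N Ξ m c n 4 := by
  have hC := measurable_recCond_network h m c n
  have hE := h.measurable_edge []
  have hY := measurable_edgeCond_network h m c n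
  rw [← lintegral_edge_mul_recCond' h, ← lintegral_edge_pow_mul_recCond h,
    ← lintegral_edge_pow_mul_recCond h, ← lintegral_recCond,
    ← lintegral_edgeCond, ← lintegral_add_left hY,
    ← lintegral_add_left hC, ← lintegral_add_left (by fun_prop)]
  refine lintegral_mono_ae ?_
  filter_upwards [ae_recCond_eq_coe h hfin] with ω ⟨x, hx⟩
  rw [edgeCond, hx]
  exact le_series_taylor _ _

lemma condMoment_one_le : condMoment P N Ξ m c n 1 ≤
    edgeMoment P N Ξ m c n 1 + xiMoment P ξ 1 * condMoment P N Ξ m c n 2 := by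
  rw [← lintegral_edge_mul_recCond' h, ← lintegral_recCond,
    ← lintegral_edgeCond, ← lintegral_add_left (measurable_edgeCond_network h m c n)]
  refine lintegral_mono_ae ?_
  filter_upwards [ae_recCond_eq_coe h hfin] with ω ⟨x, hx⟩
  rw [edgeCond, hx]
  exact le_series_add _ _

lemma edgeMoment_two_add_le :
    edgeMoment P N Ξ m c n 2 + 2 * (xiMoment P ξ 1 * condMoment P N Ξ m c n 3) ≤
    condMoment P N Ξ m c n 2 + 3 * (xiMoment P ξ 2 * condMoment P N Ξ m c n 4) := by
  have hC := measurable_recCond_network h m c n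
  have hE := h.measurable_edge []
  have hY := measurable_edgeCond_network h m c n
  rw [← lintegral_edge_mul_recCond' h, ← lintegral_edge_pow_mul_recCond h,
    ← lintegral_const_mul _ (by fun_prop), ← lintegral_const_mul _ (by fun_prop), edgeMoment,
    condMoment, ← lintegral_add_left (by fun_prop), ← lintegral_add_left (by fun_prop)]
  refine lintegral_mono_ae ?_
  filter_upwards [ae_recCond_eq_coe h hfin] with ω ⟨x, hx⟩
  rw [edgeCond, hx]
  exact series_sq_taylor_le _ _

lemma condMoment_two_le : condMoment P N Ξ m c n 2 ≤
    edgeMoment P N Ξ m c n 2 + 2 * (xiMoment P ξ 1 * condMoment P N Ξ m c n 3) := by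
  have hC := measurable_recCond_network h m c n
  have hE := h.measurable_edge []
  have hY := measurable_edgeCond_network h m c n
  rw [← lintegral_edge_mul_recCond' h, ← lintegral_const_mul _ (by fun_prop), edgeMoment,
    condMoment, ← lintegral_add_left (by fun_prop)]
  refine lintegral_mono_ae ?_
  filter_upwards [ae_recCond_eq_coe h hfin] with ω ⟨x, hx⟩
  rw [edgeCond, hx]
  exact le_series_sq_taylor _ _

lemma condMoment_three_le : condMoment P N Ξ m c n 3 ≤
    edgeMoment P N Ξ m c n 3 + 3 * (xiMoment P ξ 1 * condMoment P N Ξ m c n 4) := by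
  have hC := measurable_recCond_network h m c n
  have hE := h.measurable_edge []
  have hY := measurable_edgeCond_network h m c n
  rw [← lintegral_edge_mul_recCond' h, ← lintegral_const_mul _ (by fun_prop), edgeMoment,
    condMoment, ← lintegral_add_left (by fun_prop)]
  refine lintegral_mono_ae ?_
  filter_upwards [ae_recCond_eq_coe h hfin] with ω ⟨x, hx⟩
  rw [edgeCond, hx]
  exact le_series_cube_taylor _ _

end Moments

/-! ### Exact one-step formulas for the first four moments. -/

section Recursion

variable {Ω : Type*} [MeasurableSpace Ω] {P : Measure Ω} {ν : Ω → ℕ} {ξ : Ω → ℝ≥0}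
  {N : List ℕ → Ω → ℕ} {Ξ : List ℕ → Ω → ℝ≥0} {m : ℝ≥0}
  (h : IsBranchingNetwork P ν ξ N Ξ) (hm : 0 < m) (c : ℝ≥0∞) (n : ℕ)
include h hm

lemma condMoment_succ_one : condMoment P N Ξ m c (n + 1) 1 =
    (m : ℝ≥0∞)⁻¹ * (factorialMoment P ν 1 * edgeMoment P N Ξ m c n 1) := by
  have hD : Measurable fun ω => ((N [] ω).descFactorial 1 : ℝ≥0∞) :=
    (measurable_from_nat (f := fun k : ℕ => (k.descFactorial 1 : ℝ≥0∞))).comp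
      (h.measurable_offspring [])
  rw [condMoment_succ h hm, ← factorialMoment_eq h, pow_one, ← lintegral_mul_const _ hD]
  simp only [pow_one, (hasMoments_edgeCond h m c n).lintegral_sum, Nat.descFactorial_one]

lemma condMoment_succ_two : condMoment P N Ξ m c (n + 1) 2 =
    (m : ℝ≥0∞)⁻¹ ^ 2 * (factorialMoment P ν 1 * edgeMoment P N Ξ m c n 2 +
      factorialMoment P ν 2 * edgeMoment P N Ξ m c n 1 ^ 2) := by
  have hD : ∀ j, Measurable fun ω => ((N [] ω).descFactorial j : ℝ≥0∞) := fun j =>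
    (measurable_from_nat (f := fun k : ℕ => (k.descFactorial j : ℝ≥0∞))).comp
      (h.measurable_offspring [])
  rw [condMoment_succ h hm, ← factorialMoment_eq h, ← factorialMoment_eq h,
    ← lintegral_mul_const _ (hD 1), ← lintegral_mul_const _ (hD 2),
    ← lintegral_add_left ((hD 1).mul_const _)]
  simp only [(hasMoments_edgeCond h m c n).lintegral_sum_sq, Nat.descFactorial_one]

lemma condMoment_succ_three : condMoment P N Ξ m c (n + 1) 3 =
    (m : ℝ≥0∞)⁻¹ ^ 3 * (factorialMoment P ν 1 * edgeMoment P N Ξ m c n 3 +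
      factorialMoment P ν 2 * (3 * (edgeMoment P N Ξ m c n 2 * edgeMoment P N Ξ m c n 1)) +
      factorialMoment P ν 3 * edgeMoment P N Ξ m c n 1 ^ 3) := by
  have hD : ∀ j, Measurable fun ω => ((N [] ω).descFactorial j : ℝ≥0∞) := fun j =>
    (measurable_from_nat (f := fun k : ℕ => (k.descFactorial j : ℝ≥0∞))).comp
      (h.measurable_offspring [])
  have hD1 := hD 1
  have hD2 := hD 2
  have hD3 := hD 3
  rw [condMoment_succ h hm, ← factorialMoment_eq h, ← factorialMoment_eq h,
    ← factorialMoment_eq h,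
    ← lintegral_mul_const _ (hD 1), ← lintegral_mul_const _ (hD 2), ← lintegral_mul_const _ (hD 3),
    ← lintegral_add_left (by fun_prop),
    ← lintegral_add_left (by fun_prop)]
  simp only [(hasMoments_edgeCond h m c n).lintegral_sum_cube, Nat.descFactorial_one]

lemma condMoment_succ_four : condMoment P N Ξ m c (n + 1) 4 =
    (m : ℝ≥0∞)⁻¹ ^ 4 * (factorialMoment P ν 1 * edgeMoment P N Ξ m c n 4 +
      factorialMoment P ν 2 * (4 * (edgeMoment P N Ξ m c n 3 * edgeMoment P N Ξ m c n 1) +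
        3 * edgeMoment P N Ξ m c n 2 ^ 2) +
      factorialMoment P ν 3 * (6 * (edgeMoment P N Ξ m c n 2 * edgeMoment P N Ξ m c n 1 ^ 2)) +
      factorialMoment P ν 4 * edgeMoment P N Ξ m c n 1 ^ 4) := by
  have hD : ∀ j, Measurable fun ω => ((N [] ω).descFactorial j : ℝ≥0∞) := fun j =>
    (measurable_from_nat (f := fun k : ℕ => (k.descFactorial j : ℝ≥0∞))).comp
      (h.measurable_offspring [])
  have hD1 := hD 1
  have hD2 := hD 2
  have hD3 := hD 3
  have hD4 := hD 4
  rw [condMoment_succ h hm, ← factorialMoment_eq h, ← factorialMoment_eq h,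
    ← factorialMoment_eq h, ← factorialMoment_eq h,
    ← lintegral_mul_const _ (hD 1), ← lintegral_mul_const _ (hD 2), ← lintegral_mul_const _ (hD 3),
    ← lintegral_mul_const _ (hD 4), ← lintegral_add_left (by fun_prop),
    ← lintegral_add_left (by fun_prop), ← lintegral_add_left (by fun_prop)]
  simp only [(hasMoments_edgeCond h m c n).lintegral_sum_pow_four, Nat.descFactorial_one]

end Recursion

/-! ### Sequences of polynomial decay -/

section Decay

/-- `f n = O(n⁻ᵏ)`. -/
def DecayO (k : ℕ) (f : ℕ → ℝ) : Prop := f =O[atTop] fun n : ℕ => ((n : ℝ)⁻¹) ^ k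

variable {f g : ℕ → ℝ} {j k : ℕ}

lemma DecayO.add (hf : DecayO k f) (hg : DecayO k g) : DecayO k fun n => f n + g n :=
  IsBigO.add hf hg

lemma DecayO.sub (hf : DecayO k f) (hg : DecayO k g) : DecayO k fun n => f n - g n :=
  IsBigO.sub hf hg

lemma DecayO.const_mul (hf : DecayO k f) (c : ℝ) : DecayO k fun n => c * f n :=
  IsBigO.const_mul_left hf c

lemma DecayO.mul (hf : DecayO j f) (hg : DecayO k g) : DecayO (j + k) fun n => f n * g n := by
  simpa only [DecayO, pow_add] using IsBigO.mul hf hg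

lemma DecayO.pow (hf : DecayO 1 f) (k : ℕ) : DecayO k fun n => f n ^ k := by
  simpa only [DecayO, pow_one] using IsBigO.pow hf k

lemma DecayO.mono (hf : DecayO k f) (hjk : j ≤ k) : DecayO j f := by
  refine IsBigO.trans hf (IsBigO.of_bound 1 ?_)
  filter_upwards [eventually_ge_atTop 1] with n hn
  have h1 : (1 : ℝ) ≤ n := by exact_mod_cast hn
  have h2 : (n : ℝ)⁻¹ ≤ 1 := inv_le_one_of_one_le₀ h1
  have h3 : (0 : ℝ) ≤ (n : ℝ)⁻¹ := by positivity
  rw [one_mul, Real.norm_of_nonneg (by positivity), Real.norm_of_nonneg (by positivity)]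
  exact pow_le_pow_of_le_one h3 h2 hjk

lemma DecayO.congr' (hf : DecayO k f) (h : ∀ᶠ n in atTop, f n = g n) : DecayO k g :=
  IsBigO.congr' hf h EventuallyEq.rfl

lemma DecayO.of_abs_le (hg : DecayO k g) (h : ∀ᶠ n in atTop, |f n| ≤ g n) : DecayO k f := by
  refine IsBigO.trans (IsBigO.of_bound 1 ?_) hg
  filter_upwards [h] with n hn
  rw [one_mul, Real.norm_eq_abs, Real.norm_eq_abs]
  exact hn.trans (le_abs_self _)

lemma DecayO.comp_succ (hf : DecayO k f) : DecayO k fun n => f (n + 1) := by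
  have h1 : (fun n => f (n + 1)) =O[atTop] fun n : ℕ => (((n + 1 : ℕ) : ℝ)⁻¹) ^ k :=
    IsBigO.comp_tendsto hf (tendsto_add_atTop_nat 1)
  refine h1.trans (IsBigO.of_bound 1 ?_)
  filter_upwards [eventually_ge_atTop 1] with n hn
  have h1 : (1 : ℝ) ≤ n := by exact_mod_cast hn
  rw [one_mul, Real.norm_of_nonneg (by positivity), Real.norm_of_nonneg (by positivity)]
  gcongr
  simp

lemma tendsto_succ_div_pow (k : ℕ) :
    Tendsto (fun n : ℕ => (((n : ℝ) + 1) / n) ^ k) atTop (nhds 1) := by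
  have h1 : Tendsto (fun n : ℕ => 1 + (n : ℝ)⁻¹) atTop (nhds (1 + 0)) :=
    tendsto_const_nhds.add tendsto_inv_atTop_nhds_zero_nat
  have h2 := h1.pow k
  rw [add_zero, one_pow] at h2
  refine h2.congr' ?_
  filter_upwards [eventually_ge_atTop 1] with n hn
  have : (n : ℝ) ≠ 0 := by positivity
  field_simp

/-- A contraction inherits the polynomial decay of its forcing term: after multiplication by `n ^ k`
the factor becomes `ρ ((n+1)/n) ^ k`, which is eventually below a constant less than one. -/
lemma decayO_of_abs_succ_le {ρ : ℝ} (hρ0 : 0 ≤ ρ) (hρ : ρ < 1) (hg : DecayO k g)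
    (h : ∀ᶠ n in atTop, |f (n + 1)| ≤ ρ * |f n| + g n) : DecayO k f := by
  obtain ⟨K, hK0, hK⟩ := IsBigO.exists_nonneg hg
  rw [isBigOWith_iff] at hK
  set ρ' := (1 + ρ) / 2
  have h1 : ∀ᶠ n : ℕ in atTop, ρ * (((n : ℝ) + 1) / n) ^ k ≤ ρ' := by
    have := ((tendsto_succ_div_pow k).const_mul ρ).eventually_lt_const
      (show ρ * 1 < ρ' by simp only [ρ']; linarith)
    exact this.mono fun n hn => hn.le
  have h2 : ∀ᶠ n : ℕ in atTop, (((n : ℝ) + 1) / n) ^ k ≤ 2 :=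
    ((tendsto_succ_div_pow k).eventually_lt_const one_lt_two).mono fun n hn => hn.le
  obtain ⟨n₀, hn₀⟩ := eventually_atTop.1 (((h.and hK).and (h1.and h2)).and (eventually_ge_atTop 1))
  set v : ℕ → ℝ := fun n => (n : ℝ) ^ k * |f n|
  have hstep : ∀ n ≥ n₀, v (n + 1) ≤ ρ' * v n + 2 * K := by
    intro n hn
    obtain ⟨⟨⟨h3, h4⟩, h5, h6⟩, h7⟩ := hn₀ n hn
    have hn1 : (0 : ℝ) < n := by exact_mod_cast h7
    have h8 : g n ≤ K * ((n : ℝ)⁻¹) ^ k := by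
      rw [Real.norm_eq_abs, Real.norm_of_nonneg (by positivity)] at h4
      exact (le_abs_self _).trans h4
    have h9 : ((n : ℝ) + 1) ^ k = (((n : ℝ) + 1) / n) ^ k * (n : ℝ) ^ k := by
      rw [← mul_pow, div_mul_cancel₀ _ hn1.ne']
    calc v (n + 1) = ((n : ℝ) + 1) ^ k * |f (n + 1)| := by simp [v]
      _ ≤ ((n : ℝ) + 1) ^ k * (ρ * |f n| + K * ((n : ℝ)⁻¹) ^ k) := by gcongr; linarith
      _ = ρ * (((n : ℝ) + 1) / n) ^ k * v n + (((n : ℝ) + 1) / n) ^ k * K := by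
        rw [h9, inv_pow]
        simp only [v]
        field_simp
      _ ≤ ρ' * v n + 2 * K := by
        have : 0 ≤ v n := by positivity
        gcongr
  have hρ' : ρ' < 1 := by simp only [ρ']; linarith
  have hρ'0 : 0 ≤ ρ' := by simp only [ρ']; linarith
  -- `[0, B]` contains the starting value and is preserved by `v ↦ ρ' * v + 2 * K`.
  set B := max (v n₀) (2 * K / (1 - ρ'))
  have hB : ρ' * B + 2 * K ≤ B := by
    have : 2 * K / (1 - ρ') ≤ B := le_max_right _ _
    rw [div_le_iff₀ (by linarith)] at this
    linarith
  have hbound : ∀ n ≥ n₀, v n ≤ B := by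
    intro n hn
    induction n, hn using Nat.le_induction with
    | base => exact le_max_left _ _
    | succ n hn ih =>
      calc v (n + 1) ≤ ρ' * v n + 2 * K := hstep n hn
        _ ≤ ρ' * B + 2 * K := by gcongr
        _ ≤ B := hB
  refine IsBigO.of_bound B ?_
  filter_upwards [eventually_ge_atTop n₀, eventually_ge_atTop 1] with n hn hn1
  have hn1 : (0 : ℝ) < n := by exact_mod_cast hn1
  rw [Real.norm_eq_abs, Real.norm_of_nonneg (by positivity), inv_pow, ← div_eq_mul_inv,
    le_div_iff₀ (by positivity), mul_comm]
  exact hbound n hn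

lemma decayO_of_succ_sub {ρ : ℝ} (hρ0 : 0 ≤ ρ) (hρ : ρ < 1)
    (h : DecayO k fun n => f (n + 1) - ρ * f n) : DecayO k f := by
  refine decayO_of_abs_succ_le hρ0 hρ (IsBigO.norm_left h) (Eventually.of_forall fun n => ?_)
  rw [Real.norm_eq_abs]
  calc |f (n + 1)| = |ρ * f n + (f (n + 1) - ρ * f n)| := by ring_nf
    _ ≤ |ρ * f n| + |f (n + 1) - ρ * f n| := abs_add_le _ _
    _ = ρ * |f n| + |f (n + 1) - ρ * f n| := by rw [abs_mul, abs_of_nonneg hρ0]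

end Decay

/-! ### Sequences with prescribed increments -/

section Increments

variable {f : ℕ → ℝ}

lemma inv_le_two_mul_log_succ_sub {n : ℕ} (hn : 1 ≤ n) :
    (n : ℝ)⁻¹ ≤ 2 * (Real.log ((n : ℝ) + 1) - Real.log n) := by
  have h1 : (1 : ℝ) ≤ n := by exact_mod_cast hn
  have h2 := Real.one_sub_inv_le_log_of_pos (x := ((n : ℝ) + 1) / n) (by positivity)
  rw [Real.log_div (by positivity) (by positivity), inv_div] at h2
  have h3 : (n : ℝ)⁻¹ ≤ 2 * (1 - (n : ℝ) / (n + 1)) := by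
    rw [← sub_nonneg]
    have : 2 * (1 - (n : ℝ) / (n + 1)) - (n : ℝ)⁻¹ = (n - 1) / (n * (n + 1)) := by
      field_simp
      ring
    rw [this]
    have : (0 : ℝ) ≤ n - 1 := by linarith
    positivity
  linarith

lemma log_succ_sub_le {n : ℕ} (hn : 1 ≤ n) :
    Real.log ((n : ℝ) + 1) - Real.log n ≤ (n : ℝ)⁻¹ := by
  have h1 : (1 : ℝ) ≤ n := by exact_mod_cast hn
  have h2 := Real.log_le_sub_one_of_pos (x := ((n : ℝ) + 1) / n) (by positivity)
  rw [Real.log_div (by positivity) (by positivity)] at h2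
  have : ((n : ℝ) + 1) / n - 1 = (n : ℝ)⁻¹ := by
    field_simp
    ring
  linarith

lemma decayO_log_succ_sub :
    DecayO 2 fun n : ℕ => Real.log ((n : ℝ) + 1) - Real.log n - (n : ℝ)⁻¹ := by
  refine IsBigO.of_bound 1 ?_
  filter_upwards [eventually_ge_atTop 1] with n hn
  have h1 : (1 : ℝ) ≤ n := by exact_mod_cast hn
  have h2 := Real.one_sub_inv_le_log_of_pos (x := ((n : ℝ) + 1) / n) (by positivity)
  rw [Real.log_div (by positivity) (by positivity), inv_div] at h2
  have h3 := log_succ_sub_le hn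
  have h4 : (n : ℝ)⁻¹ - ((n : ℝ)⁻¹) ^ 2 ≤ 1 - (n : ℝ) / (n + 1) := by
    rw [← sub_nonneg]
    have : 1 - (n : ℝ) / (n + 1) - ((n : ℝ)⁻¹ - ((n : ℝ)⁻¹) ^ 2) = 1 / (n ^ 2 * (n + 1)) := by
      field_simp
      ring
    rw [this]
    positivity
  rw [one_mul, Real.norm_eq_abs, Real.norm_of_nonneg (by positivity), abs_le]
  have h5 : (0 : ℝ) ≤ ((n : ℝ)⁻¹) ^ 2 := by positivity
  constructor <;> linarith

lemma eventually_one_le_log : ∀ᶠ n : ℕ in atTop, 1 ≤ Real.log n :=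
  (Real.tendsto_log_atTop.comp tendsto_natCast_atTop_atTop).eventually_ge_atTop 1

lemma isBigO_log_of_increments (h : DecayO 1 fun n => f (n + 1) - f n) :
    f =O[atTop] fun n : ℕ => Real.log n := by
  obtain ⟨K, hK0, hK⟩ := IsBigO.exists_nonneg h
  rw [isBigOWith_iff] at hK
  obtain ⟨n₀, hn₀⟩ := eventually_atTop.1 (hK.and (eventually_ge_atTop 1))
  have hbound : ∀ n ≥ n₀, |f n| ≤ |f n₀| + 2 * K * (Real.log n - Real.log n₀) := by
    intro n hn
    induction n, hn using Nat.le_induction with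
    | base => simp
    | succ n hn ih =>
      obtain ⟨h1, h2⟩ := hn₀ n hn
      have h3 := inv_le_two_mul_log_succ_sub h2
      rw [Real.norm_eq_abs, pow_one, Real.norm_of_nonneg (by positivity)] at h1
      have h4 : |f (n + 1)| ≤ |f n| + |f (n + 1) - f n| := by
        calc |f (n + 1)| = |f n + (f (n + 1) - f n)| := by ring_nf
          _ ≤ _ := abs_add_le _ _
      have h5 := mul_le_mul_of_nonneg_left h3 hK0
      push_cast
      linarith
  refine IsBigO.of_bound (|f n₀| + 2 * K) ?_
  filter_upwards [eventually_ge_atTop n₀, eventually_one_le_log] with n hn hlog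
  rw [Real.norm_eq_abs, Real.norm_of_nonneg (by linarith)]
  have h1 := hbound n hn
  have h2 : 0 ≤ Real.log n₀ := Real.log_natCast_nonneg _
  have h3 : |f n₀| ≤ |f n₀| * Real.log n := le_mul_of_one_le_right (abs_nonneg _) hlog
  have h4 : 0 ≤ 2 * K * Real.log n₀ := by positivity
  linarith

lemma tendsto_log_add_two_div :
    Tendsto (fun n : ℕ => (Real.log n + 2) / n) atTop (nhds 0) := by
  have h1 : Tendsto (fun n : ℕ => Real.log n / (n : ℝ)) atTop (nhds 0) := by
    have := Real.isLittleO_log_id_atTop.tendsto_div_nhds_zero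
    exact this.comp tendsto_natCast_atTop_atTop
  have h2 : Tendsto (fun n : ℕ => (2 : ℝ) / n) atTop (nhds 0) :=
    tendsto_const_div_atTop_nhds_zero_nat 2
  have h3 := h1.add h2
  rw [add_zero] at h3
  exact h3.congr fun n => (add_div _ _ _).symm

/-- A telescoping majorant: (log x + 2)/x has derivative -(log x + 1)/x². The factor 2 pays for
replacing `n * (n + 1)` by `n ^ 2`. -/
lemma log_div_sq_le {n : ℕ} (hn : 1 ≤ n) : Real.log n / (n : ℝ) ^ 2 ≤
    2 * ((Real.log n + 2) / n - (Real.log ((n : ℝ) + 1) + 2) / (n + 1)) := by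
  have h1 : (1 : ℝ) ≤ n := by exact_mod_cast hn
  have h2 := log_succ_sub_le hn
  have h3 : 0 ≤ Real.log n := Real.log_natCast_nonneg _
  have h4 : (Real.log ((n : ℝ) + 1) + 2) / (n + 1) ≤ (Real.log n + (n : ℝ)⁻¹ + 2) / (n + 1) := by
    gcongr
    linarith
  have h5 : (Real.log n + 2) / n - (Real.log n + (n : ℝ)⁻¹ + 2) / (n + 1) =
      (Real.log n + 1) / (n * (n + 1)) := by
    field_simp
    ring
  have h6 : Real.log n / (n : ℝ) ^ 2 ≤ 2 * ((Real.log n + 1) / (n * (n + 1))) := by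
    rw [← mul_div_assoc, div_le_div_iff₀ (by positivity) (by positivity)]
    nlinarith [mul_nonneg h3 (show (0 : ℝ) ≤ n * (n - 1) by nlinarith)]
  linarith

/-- The increments are dominated by those of the decreasing tail `T`, so the sequence is Cauchy and
its distance to the limit is at most `T n`. -/
lemma exists_limit_of_increments
    (h : (fun n => f (n + 1) - f n) =O[atTop] fun n : ℕ => Real.log n / (n : ℝ) ^ 2) :
    ∃ c : ℝ, (fun n => f n - c) =O[atTop] fun n : ℕ => Real.log n / (n : ℝ) := by
  obtain ⟨K, hK0, hK⟩ := IsBigO.exists_nonneg h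
  rw [isBigOWith_iff] at hK
  obtain ⟨n₀, hn₀⟩ := eventually_atTop.1 (hK.and (eventually_ge_atTop 1))
  set T : ℕ → ℝ := fun n => 2 * K * ((Real.log n + 2) / n)
  have hT : Tendsto T atTop (nhds 0) := by
    simpa using tendsto_log_add_two_div.const_mul (2 * K)
  have hT0 : ∀ n, 0 ≤ T n := fun n => by
    have : 0 ≤ Real.log n := Real.log_natCast_nonneg _
    positivity
  have hstep : ∀ n ≥ n₀, |f (n + 1) - f n| ≤ T n - T (n + 1) := by
    intro n hn
    obtain ⟨h1, h2⟩ := hn₀ n hn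
    have h3 := mul_le_mul_of_nonneg_left (log_div_sq_le h2) hK0
    have h4 : 0 ≤ Real.log n := Real.log_natCast_nonneg _
    rw [Real.norm_eq_abs, Real.norm_of_nonneg (by positivity)] at h1
    simp only [T]
    push_cast
    linarith
  have hdist : ∀ n ≥ n₀, ∀ j, |f (n + j) - f n| ≤ T n - T (n + j) := by
    intro n hn j
    induction j with
    | zero => simp
    | succ j ih =>
      have h1 := hstep (n + j) (by omega)
      have h2 : |f (n + (j + 1)) - f n| ≤ |f (n + j + 1) - f (n + j)| + |f (n + j) - f n| := by
        calc _ = |(f (n + j + 1) - f (n + j)) + (f (n + j) - f n)| := by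
              rw [← add_assoc]
              ring_nf
          _ ≤ _ := abs_add_le _ _
      rw [← add_assoc n j 1] at h2 ⊢
      linarith
  have hcauchy : CauchySeq fun j => f (j + n₀) := by
    refine cauchySeq_of_le_tendsto_0' (fun j => T (j + n₀)) (fun a b hab => ?_)
      ((tendsto_add_atTop_iff_nat n₀).2 hT)
    obtain ⟨i, rfl⟩ := Nat.exists_eq_add_of_le hab
    rw [dist_comm, Real.dist_eq, add_right_comm]
    linarith [hdist (a + n₀) (by omega) i, hT0 (a + n₀ + i)]
  obtain ⟨c, hc⟩ := cauchySeq_tendsto_of_complete hcauchy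
  replace hc := (tendsto_add_atTop_iff_nat n₀).1 hc
  refine ⟨c, ?_⟩
  have hlim : ∀ n ≥ n₀, |f n - c| ≤ T n := by
    intro n hn
    rw [abs_sub_comm]
    have h1 : Tendsto (fun j => |f (n + j) - f n|) atTop (nhds |c - f n|) := by
      have h2 : Tendsto (fun j => f (n + j)) atTop (nhds c) := by
        simpa only [add_comm] using (tendsto_add_atTop_iff_nat n).2 hc
      exact (h2.sub_const _).abs
    exact le_of_tendsto' h1 fun j => by linarith [hdist n hn j, hT0 (n + j)]
  refine IsBigO.of_bound (2 * K * 3) ?_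
  filter_upwards [eventually_ge_atTop n₀, eventually_one_le_log] with n hn hlog
  rw [Real.norm_eq_abs, Real.norm_of_nonneg (by positivity)]
  refine (hlim n hn).trans ?_
  simp only [T]
  rw [mul_assoc (2 * K) 3, ← mul_div_assoc 3]
  gcongr
  linarith

end Increments

/-! ### From the increments of the reciprocal to the expansion -/

/-- The increments are summed twice. The first pass gives 1/x = cn + O(log n), hence x = 1/(cn) +
O(log n / n²). Inserting this into the term `l * x n` shows that 1/x - cn - (l/c) log n converges,
with error O(log n / n). -/
lemma exists_expansion_of_inv_increments {x : ℕ → ℝ} {c l : ℝ} (hc : 0 < c)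
    (hx0 : ∀ᶠ n in atTop, x n ≠ 0) (hx : DecayO 1 x)
    (h : DecayO 2 fun n => (x (n + 1))⁻¹ - (x n)⁻¹ - c - l * x n) :
    ∃ c₀ : ℝ, (fun n : ℕ => x n - (1 / (c * n) - l / c / c ^ 2 * (Real.log n / (n : ℝ) ^ 2)
      - c₀ / c ^ 2 * (1 / (n : ℝ) ^ 2))) =O[atTop] fun n : ℕ => Real.log n ^ 2 / (n : ℝ) ^ 3 := by
  set e : ℕ → ℝ := fun n => (x n)⁻¹ - c * n with he_def
  have he : e =O[atTop] fun n : ℕ => Real.log n := by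
    refine isBigO_log_of_increments (((h.mono one_le_two).add (hx.const_mul l)).congr'
      (Eventually.of_forall fun n => ?_))
    simp only [e]
    push_cast
    ring
  have hinv : DecayO 1 fun n : ℕ => (n : ℝ)⁻¹ := by
    simpa [DecayO] using isBigO_refl (fun n : ℕ => (n : ℝ)⁻¹) atTop
  have hone : (fun _ : ℕ => (1 : ℝ)) =O[atTop] fun n : ℕ => Real.log n := by
    refine IsBigO.of_bound 1 ?_
    filter_upwards [eventually_one_le_log] with n hn
    rw [one_mul, Real.norm_of_nonneg (by linarith), Real.norm_of_nonneg (by linarith)]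
    exact hn
  have hsq : ∀ {g : ℕ → ℝ}, DecayO 2 g → g =O[atTop] fun n : ℕ => Real.log n / (n : ℝ) ^ 2 := by
    intro g hg
    have := hone.mul hg
    refine this.congr (fun n => one_mul _) fun n => ?_
    rw [inv_pow, div_eq_mul_inv]
  have hx1 : (fun n : ℕ => x n - (c * n)⁻¹) =O[atTop] fun n : ℕ => Real.log n / (n : ℝ) ^ 2 := by
    have h1 := (he.mul (hx.mul hinv)).const_mul_left (-c⁻¹)
    refine h1.congr' ?_ (Eventually.of_forall fun n => ?_)
    · filter_upwards [hx0, eventually_ge_atTop 1] with n hn hn1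
      have : (n : ℝ) ≠ 0 := by positivity
      simp only [e]
      field_simp
      ring
    · simp only
      rw [inv_pow, div_eq_mul_inv]
  obtain ⟨c₀, hc₀⟩ := exists_limit_of_increments (f := fun n => e n - l / c * Real.log n) (by
    have h1 := ((hsq h).add (hx1.const_mul_left l)).sub
      (hsq (decayO_log_succ_sub.const_mul (l / c)))
    refine h1.congr' (Eventually.of_forall fun n => ?_) EventuallyEq.rfl
    simp only [e, mul_inv]
    push_cast
    field_simp
    ring)
  refine ⟨c₀, ?_⟩
  -- The conclusion rests on the exact identity x = 1/(cn) - e/(cn)² + e²x/(cn)², where 1/x = cn +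
  -- e; `h1` bounds its last term.
  have h1 : (fun n : ℕ => e n ^ 2 * (x n * (n : ℝ)⁻¹ ^ 2)) =O[atTop]
      fun n : ℕ => Real.log n ^ 2 / (n : ℝ) ^ 3 := by
    refine ((he.pow 2).mul (hx.mul (hinv.pow 2))).congr (fun n => rfl) fun n => ?_
    rw [inv_pow, div_eq_mul_inv]
  have h2 : (fun n : ℕ => (e n - l / c * Real.log n - c₀) * (n : ℝ)⁻¹ ^ 2) =O[atTop]
      fun n : ℕ => Real.log n ^ 2 / (n : ℝ) ^ 3 := by
    have h3 := (hc₀.mul (hinv.pow 2)).mul hone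
    refine h3.congr (fun n => mul_one _) fun n => ?_
    rw [inv_pow]
    ring
  refine ((h1.sub h2).const_mul_left (c⁻¹ ^ 2)).congr' ?_ EventuallyEq.rfl
  filter_upwards [hx0, eventually_ge_atTop 1] with n hn hn1
  have : (n : ℝ) ≠ 0 := by positivity
  simp only [e]
  field_simp
  ring

/-! ### The expansion of the first moment from the recursion for the moments -/

/-- Sequences `x, y, z, w` behaving like the first four moments of the conductances, and `q, t` like
the second and third moments of the conductances in series with an edge. -/
structure MomentRecursion (ρ a₁ a₂ b₁ b₂ b₃ K : ℝ) (x y z w q t : ℕ → ℝ) : Prop where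
  nonneg_x : ∀ n, 0 ≤ x n
  nonneg_y : ∀ n, 0 ≤ y n
  nonneg_z : ∀ n, 0 ≤ z n
  nonneg_w : ∀ n, 0 ≤ w n
  nonneg_q : ∀ n, 0 ≤ q n
  nonneg_t : ∀ n, 0 ≤ t n
  y_succ : ∀ᶠ n in atTop, y (n + 1) = ρ * q n + a₁ * x (n + 1) ^ 2
  z_succ : ∀ᶠ n in atTop,
    z (n + 1) = ρ ^ 2 * t n + 3 * ρ * a₁ * (q n * x (n + 1)) + a₂ * x (n + 1) ^ 3
  w_succ : ∀ᶠ n in atTop, w (n + 1) ≤ ρ ^ 3 * w n +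
    K * (t n * x (n + 1) + q n ^ 2 + q n * x (n + 1) ^ 2 + x (n + 1) ^ 4)
  x_le : ∀ᶠ n in atTop, x (n + 1) + b₁ * y n ≤ x n + b₂ * z n
  le_x : ∀ᶠ n in atTop, x n + b₂ * z n ≤ x (n + 1) + b₁ * y n + b₃ * w n
  q_le : ∀ᶠ n in atTop, q n ≤ y n
  q_add_le : ∀ᶠ n in atTop, q n + 2 * (b₁ * z n) ≤ y n + 3 * (b₂ * w n)
  le_q_add : ∀ᶠ n in atTop, y n ≤ q n + 2 * (b₁ * z n)
  t_le : ∀ᶠ n in atTop, t n ≤ z n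
  le_t_add : ∀ᶠ n in atTop, z n ≤ t n + 3 * (b₁ * w n)

namespace MomentRecursion

variable {ρ a₁ a₂ b₁ b₂ b₃ K : ℝ} {x y z w q t : ℕ → ℝ}
  (h : MomentRecursion ρ a₁ a₂ b₁ b₂ b₃ K x y z w q t) (hρ0 : 0 < ρ) (hρ1 : ρ < 1)
  (hx : DecayO 1 x)
include h hρ0 hρ1 hx

/-- The bootstrap common to `y`, `z` and `w`: the moment of order j is contracted by `ρ ^ (j - 1)`
and forced by products of lower moments of total order j, each order being worth one power of 1/n.
-/
lemma decayO_y : DecayO 2 y := by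
  refine decayO_of_abs_succ_le hρ0.le hρ1 ((hx.comp_succ.pow 2).const_mul a₁) ?_
  filter_upwards [h.y_succ, h.q_le] with n h1 h2
  rw [abs_of_nonneg (h.nonneg_y _), abs_of_nonneg (h.nonneg_y _), h1]
  gcongr

lemma decayO_q : DecayO 2 q := by
  refine (h.decayO_y hρ0 hρ1 hx).of_abs_le ?_
  filter_upwards [h.q_le] with n h1
  rwa [abs_of_nonneg (h.nonneg_q _)]

lemma decayO_z : DecayO 3 z := by
  have hp := hx.comp_succ
  refine decayO_of_abs_succ_le (ρ := ρ ^ 2) (by positivity) (by nlinarith)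
    ((((h.decayO_q hρ0 hρ1 hx).mul hp).const_mul (3 * ρ * a₁)).add ((hp.pow 3).const_mul a₂)) ?_
  filter_upwards [h.z_succ, h.t_le] with n h1 h2
  rw [abs_of_nonneg (h.nonneg_z _), abs_of_nonneg (h.nonneg_z _), h1, add_assoc]
  gcongr

lemma decayO_t : DecayO 3 t := by
  refine (h.decayO_z hρ0 hρ1 hx).of_abs_le ?_
  filter_upwards [h.t_le] with n h1
  rwa [abs_of_nonneg (h.nonneg_t _)]

lemma decayO_w : DecayO 4 w := by
  have hp := hx.comp_succ
  have hq := h.decayO_q hρ0 hρ1 hx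
  have hq2 : DecayO 4 fun n => q n ^ 2 := by
    simpa only [sq] using hq.mul hq
  refine decayO_of_abs_succ_le (ρ := ρ ^ 3) (by positivity) (pow_lt_one₀ hρ0.le hρ1 (by simp))
    ((((((h.decayO_t hρ0 hρ1 hx).mul hp).add hq2).add (hq.mul (hp.pow 2))).add
      (hp.pow 4)).const_mul K) ?_
  filter_upwards [h.w_succ] with n h1
  rw [abs_of_nonneg (h.nonneg_w _), abs_of_nonneg (h.nonneg_w _)]
  exact h1

lemma decayO_x_taylor : DecayO 4 fun n => x (n + 1) - x n + b₁ * y n - b₂ * z n := by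
  refine ((h.decayO_w hρ0 hρ1 hx).const_mul b₃).of_abs_le ?_
  filter_upwards [h.x_le, h.le_x] with n h1 h2
  rw [abs_le]
  constructor <;> linarith

lemma decayO_q_taylor : DecayO 4 fun n => q n - y n + 2 * b₁ * z n := by
  refine ((h.decayO_w hρ0 hρ1 hx).const_mul (3 * b₂)).of_abs_le ?_
  filter_upwards [h.q_add_le, h.le_q_add] with n h1 h2
  rw [abs_le]
  constructor <;> linarith

lemma decayO_t_taylor : DecayO 4 fun n => t n - z n := by
  refine ((h.decayO_w hρ0 hρ1 hx).const_mul (3 * b₁)).of_abs_le ?_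
  filter_upwards [h.t_le, h.le_t_add] with n h1 h2
  rw [abs_le]
  constructor <;> linarith

lemma decayO_x_succ_sub : DecayO 2 fun n => x (n + 1) - x n :=
  ((((h.decayO_x_taylor hρ0 hρ1 hx).mono (by norm_num)).sub
    ((h.decayO_y hρ0 hρ1 hx).const_mul b₁)).add
    (((h.decayO_z hρ0 hρ1 hx).mono (by norm_num)).const_mul b₂)).congr'
    (Eventually.of_forall fun n => by ring)

lemma decayO_x_sq_succ_sub : DecayO 3 fun n => x (n + 1) ^ 2 - x n ^ 2 :=
  ((h.decayO_x_succ_sub hρ0 hρ1 hx).mul (hx.comp_succ.add hx)).congr'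
    (Eventually.of_forall fun n => by ring)

lemma decayO_x_cube_succ_sub : DecayO 4 fun n => x (n + 1) ^ 3 - x n ^ 3 :=
  ((h.decayO_x_succ_sub hρ0 hρ1 hx).mul (((hx.comp_succ.pow 2).add
    (hx.comp_succ.mul hx)).add (hx.pow 2))).congr'
    (Eventually.of_forall fun n => by ring)

lemma decayO_q_sub_y : DecayO 3 fun n => q n - y n :=
  (((h.decayO_q_taylor hρ0 hρ1 hx).mono (by norm_num)).sub
    ((h.decayO_z hρ0 hρ1 hx).const_mul (2 * b₁))).congr'
    (Eventually.of_forall fun n => by ring)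

/-- For frozen `x`, the value `α * x ^ 2` is the fixed point of `y ↦ ρ * y + a₁ * x ^ 2`. Since `x ^
2` moves by only O(n⁻³) per step, `y` stays that close to it. -/
lemma decayO_y_sub {α : ℝ} (hα : α * (1 - ρ) = a₁) : DecayO 3 fun n => y n - α * x n ^ 2 := by
  refine decayO_of_succ_sub hρ0.le hρ1 ((((h.decayO_q_sub_y hρ0 hρ1 hx).const_mul ρ).sub
    ((h.decayO_x_sq_succ_sub hρ0 hρ1 hx).const_mul (ρ * α))).congr' ?_)
  filter_upwards [h.y_succ] with n h1
  rw [h1, ← hα]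
  ring

lemma decayO_q_sub {α : ℝ} (hα : α * (1 - ρ) = a₁) :
    DecayO 3 fun n => q n - α * x (n + 1) ^ 2 :=
  (((h.decayO_q_sub_y hρ0 hρ1 hx).add (h.decayO_y_sub hρ0 hρ1 hx hα)).sub
    ((h.decayO_x_sq_succ_sub hρ0 hρ1 hx).const_mul α)).congr'
    (Eventually.of_forall fun n => by ring)

lemma decayO_z_sub {α β : ℝ} (hα : α * (1 - ρ) = a₁)
    (hβ : β * (1 - ρ ^ 2) = 3 * ρ * a₁ * α + a₂) : DecayO 4 fun n => z n - β * x n ^ 3 := by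
  refine decayO_of_succ_sub (ρ := ρ ^ 2) (by positivity) (by nlinarith)
    (((((h.decayO_t_taylor hρ0 hρ1 hx).const_mul (ρ ^ 2)).add
      (((h.decayO_q_sub hρ0 hρ1 hx hα).mul hx.comp_succ).const_mul (3 * ρ * a₁))).sub
      ((h.decayO_x_cube_succ_sub hρ0 hρ1 hx).const_mul (ρ ^ 2 * β))).congr' ?_)
  filter_upwards [h.z_succ] with n h1
  rw [h1]
  linear_combination (x (n + 1) ^ 3) * hβ

lemma decayO_x_succ_add {α : ℝ} (hα : α * (1 - ρ) = a₁) :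
    DecayO 3 fun n => x (n + 1) - x n + b₁ * α * x n ^ 2 :=
  ((((h.decayO_x_taylor hρ0 hρ1 hx).mono (by norm_num)).sub
    ((h.decayO_y_sub hρ0 hρ1 hx hα).const_mul b₁)).add
    ((h.decayO_z hρ0 hρ1 hx).const_mul b₂)).congr' (Eventually.of_forall fun n => by ring)

lemma decayO_x_sq_succ_add {α : ℝ} (hα : α * (1 - ρ) = a₁) :
    DecayO 4 fun n => x (n + 1) ^ 2 - x n ^ 2 + 2 * (b₁ * α) * x n ^ 3 :=
  (((h.decayO_x_succ_add hρ0 hρ1 hx hα).mul (hx.comp_succ.add hx)).sub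
    (((hx.pow 2).mul (h.decayO_x_succ_sub hρ0 hρ1 hx)).const_mul (b₁ * α))).congr'
    (Eventually.of_forall fun n => by ring)

/-- The next order of the same argument. `γ` collects two cubic effects: the drift of `x ^ 2`, which
is `-2 * (b₁ * α) * x ^ 3`, and the correction `-2 * b₁ * z` in `q`. -/
lemma decayO_y_sub_sub {α β γ : ℝ} (hα : α * (1 - ρ) = a₁)
    (hβ : β * (1 - ρ ^ 2) = 3 * ρ * a₁ * α + a₂)
    (hγ : γ * (1 - ρ) = 2 * ρ * α * (b₁ * α) - 2 * ρ * b₁ * β) :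
    DecayO 4 fun n => y n - α * x n ^ 2 - γ * x n ^ 3 := by
  refine decayO_of_succ_sub hρ0.le hρ1 ((((((h.decayO_q_taylor hρ0 hρ1 hx).const_mul ρ).sub
    ((h.decayO_z_sub hρ0 hρ1 hx hα hβ).const_mul (2 * ρ * b₁))).sub
    ((h.decayO_x_sq_succ_add hρ0 hρ1 hx hα).const_mul (ρ * α))).sub
    ((h.decayO_x_cube_succ_sub hρ0 hρ1 hx).const_mul γ)).congr' ?_)
  filter_upwards [h.y_succ] with n h1
  rw [h1]
  linear_combination (x (n + 1) ^ 2) * hα + (x n ^ 3) * hγ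

lemma decayO_x_succ_expansion {α β γ : ℝ} (hα : α * (1 - ρ) = a₁)
    (hβ : β * (1 - ρ ^ 2) = 3 * ρ * a₁ * α + a₂)
    (hγ : γ * (1 - ρ) = 2 * ρ * α * (b₁ * α) - 2 * ρ * b₁ * β) :
    DecayO 4 fun n => x (n + 1) - x n + b₁ * α * x n ^ 2 + (b₁ * γ - b₂ * β) * x n ^ 3 :=
  (((h.decayO_x_taylor hρ0 hρ1 hx).sub
    ((h.decayO_y_sub_sub hρ0 hρ1 hx hα hβ hγ).const_mul b₁)).add
    ((h.decayO_z_sub hρ0 hρ1 hx hα hβ).const_mul b₂)).congr'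
    (Eventually.of_forall fun n => by ring)

lemma decayO_inv_succ_sub {α β γ δ : ℝ} (hα : α * (1 - ρ) = a₁)
    (hβ : β * (1 - ρ ^ 2) = 3 * ρ * a₁ * α + a₂)
    (hγ : γ * (1 - ρ) = 2 * ρ * α * (b₁ * α) - 2 * ρ * b₁ * β) (hδ : 0 < δ)
    (hlow : ∀ᶠ n : ℕ in atTop, δ / n ≤ x n) :
    DecayO 2 fun n => (x (n + 1))⁻¹ - (x n)⁻¹ - b₁ * α -
      (b₁ * γ - b₂ * β + (b₁ * α) ^ 2) * x n := by
  set l := b₁ * γ - b₂ * β + (b₁ * α) ^ 2 with hl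
  -- Numerator after multiplication by `x n * x (n + 1)`. Replacing `x n ^ 2` by this product
  -- creates the extra cubic term with coefficient `(b₁ * α) ^ 2` in `l`. Dividing back costs two
  -- powers of `n`, by the lower bound on `x`.
  have hnum : DecayO 4 fun n => x n - x (n + 1) - b₁ * α * (x n * x (n + 1)) -
      l * (x n ^ 2 * x (n + 1)) :=
    ((((h.decayO_x_succ_expansion hρ0 hρ1 hx hα hβ hγ).const_mul (-1)).sub
      ((hx.mul (h.decayO_x_succ_add hρ0 hρ1 hx hα)).const_mul (b₁ * α))).sub
      (((hx.pow 2).mul (h.decayO_x_succ_sub hρ0 hρ1 hx)).const_mul l)).congr'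
      (Eventually.of_forall fun n => by
        rw [hl]
        ring)
  have hpos : ∀ᶠ n in atTop, 0 < x n := by
    filter_upwards [hlow, eventually_ge_atTop 1] with n h1 h2
    have : (0 : ℝ) < n := by exact_mod_cast h2
    exact lt_of_lt_of_le (by positivity) h1
  have hpos' : ∀ᶠ n in atTop, 0 < x (n + 1) := (tendsto_add_atTop_nat 1).eventually hpos
  have hinv : (fun n => (x n)⁻¹) =O[atTop] fun n : ℕ => (n : ℝ) := by
    refine IsBigO.of_bound δ⁻¹ ?_
    filter_upwards [hlow, hpos, eventually_ge_atTop 1] with n h1 h2 h3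
    have h3 : (0 : ℝ) < n := by exact_mod_cast h3
    rw [Real.norm_of_nonneg (by positivity), Real.norm_of_nonneg (by positivity)]
    calc (x n)⁻¹ ≤ (δ / n)⁻¹ := inv_anti₀ (by positivity) h1
      _ = δ⁻¹ * n := by
        field_simp
  have hinv' : (fun n => (x (n + 1))⁻¹) =O[atTop] fun n : ℕ => (n : ℝ) := by
    have h1 : (fun n => (x (n + 1))⁻¹) =O[atTop] fun n : ℕ => ((n + 1 : ℕ) : ℝ) :=
      hinv.comp_tendsto (tendsto_add_atTop_nat 1)
    refine h1.trans (IsBigO.of_bound 2 ?_)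
    filter_upwards [eventually_ge_atTop 1] with n hn
    have : (1 : ℝ) ≤ n := by exact_mod_cast hn
    rw [Real.norm_of_nonneg (by positivity), Real.norm_of_nonneg (by positivity)]
    push_cast
    linarith
  refine ((IsBigO.mul hnum hinv).mul hinv').congr' ?_ ?_
  · filter_upwards [hpos, hpos'] with n h1 h2
    field_simp
  · filter_upwards [eventually_ge_atTop 1] with n hn
    have : (n : ℝ) ≠ 0 := by positivity
    field_simp

lemma exists_expansion {α β γ δ : ℝ} (hα : α * (1 - ρ) = a₁)
    (hβ : β * (1 - ρ ^ 2) = 3 * ρ * a₁ * α + a₂)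
    (hγ : γ * (1 - ρ) = 2 * ρ * α * (b₁ * α) - 2 * ρ * b₁ * β) (hδ : 0 < δ)
    (hlow : ∀ᶠ n : ℕ in atTop, δ / n ≤ x n) (hc : 0 < b₁ * α) :
    ∃ c₀ : ℝ, (fun n : ℕ => x n - (1 / (b₁ * α * n) -
      (b₁ * γ - b₂ * β + (b₁ * α) ^ 2) / (b₁ * α) / (b₁ * α) ^ 2 * (Real.log n / (n : ℝ) ^ 2)
      - c₀ / (b₁ * α) ^ 2 * (1 / (n : ℝ) ^ 2))) =O[atTop]
      fun n : ℕ => Real.log n ^ 2 / (n : ℝ) ^ 3 := by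
  refine exists_expansion_of_inv_increments hc ?_ hx
    (h.decayO_inv_succ_sub hρ0 hρ1 hx hα hβ hγ hδ hlow)
  filter_upwards [hlow, eventually_ge_atTop 1] with n h1 h2
  have : (0 : ℝ) < n := by exact_mod_cast h2
  exact (lt_of_lt_of_le (by positivity) h1).ne'

end MomentRecursion

/-! ### Finiteness of moments and bounds for the first moment -/

section Bounds

variable {Ω : Type*} [MeasurableSpace Ω] {P : Measure Ω} {ν : Ω → ℕ} {ξ : Ω → ℝ≥0}

lemma natCast_pow_le_one_add {j : ℕ} (hj : j ≤ 4) (a : ℕ) : a ^ j ≤ 1 + a ^ 4 := by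
  rcases Nat.eq_zero_or_pos a with rfl | ha
  · rcases j with _ | j <;> simp
  · exact (Nat.pow_le_pow_right ha hj).trans (Nat.le_add_left _ _)

lemma factorialMoment_ne_top [IsProbabilityMeasure P]
    (hν : ∫⁻ ω, (ν ω : ℝ≥0∞) ^ 4 ∂P ≠ ∞) {j : ℕ} (hj : j ≤ 4) : factorialMoment P ν j ≠ ∞ := by
  have h1 : factorialMoment P ν j ≤ ∫⁻ ω, (1 + (ν ω : ℝ≥0∞) ^ 4) ∂P := by
    refine lintegral_mono fun ω => ?_
    have h := (Nat.descFactorial_le_pow (ν ω) j).trans (natCast_pow_le_one_add hj _)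
    calc ((ν ω).descFactorial j : ℝ≥0∞) ≤ ((1 + ν ω ^ 4 : ℕ) : ℝ≥0∞) := Nat.cast_le.2 h
      _ = 1 + (ν ω : ℝ≥0∞) ^ 4 := by push_cast; rfl
  rw [lintegral_add_left measurable_const] at h1
  refine ne_top_of_le_ne_top ?_ h1
  simpa using hν

lemma xiMoment_ne_top [IsProbabilityMeasure P]
    (hξ : ∫⁻ ω, (ξ ω : ℝ≥0∞) ^ 3 ∂P ≠ ∞) {j : ℕ} (hj : j ≤ 3) : xiMoment P ξ j ≠ ∞ := by
  have h1 : xiMoment P ξ j ≤ ∫⁻ ω, (1 + (ξ ω : ℝ≥0∞) ^ 3) ∂P := by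
    refine lintegral_mono fun ω => ?_
    rcases le_total (ξ ω : ℝ≥0∞) 1 with h | h
    · exact (pow_le_one' h j).trans le_self_add
    · exact (pow_le_pow_right₀ h hj).trans le_add_self
  rw [lintegral_add_left measurable_const] at h1
  refine ne_top_of_le_ne_top ?_ h1
  simpa using hξ

lemma integral_natCast (hν : AEMeasurable ν P) (g : ℕ → ℕ) :
    ∫ ω, (g (ν ω) : ℝ) ∂P = (∫⁻ ω, (g (ν ω) : ℝ≥0∞) ∂P).toReal := by
  rw [integral_eq_lintegral_of_nonneg_ae (Eventually.of_forall fun ω => Nat.cast_nonneg _)]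
  · simp
  · exact ((measurable_from_nat (f := fun k : ℕ => (g k : ℝ))).comp_aemeasurable
      hν).aestronglyMeasurable

lemma integral_coe_pow (hξ : AEMeasurable ξ P) (j : ℕ) :
    ∫ ω, (ξ ω : ℝ) ^ j ∂P = (xiMoment P ξ j).toReal := by
  rw [integral_eq_lintegral_of_nonneg_ae (Eventually.of_forall fun ω => by positivity)]
  · simp only [xiMoment]
    congr 1
    refine lintegral_congr fun ω => ?_
    rw [ENNReal.ofReal_pow (by positivity), ENNReal.ofReal_coe_nnreal]
  · exact (hξ.coe_nnreal_real.pow_const j).aestronglyMeasurable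

lemma b₁_eq (hξ : AEMeasurable ξ P) : b₁ P ξ = (xiMoment P ξ 1).toReal := by
  rw [← integral_coe_pow hξ]
  simp [b₁]

lemma b₂_eq (hξ : AEMeasurable ξ P) : b₂ P ξ = (xiMoment P ξ 2).toReal :=
  integral_coe_pow hξ 2

lemma coe_mean (hν : AEMeasurable ν P) : (mean P ν : ℝ) = (factorialMoment P ν 1).toReal := by
  have := integral_natCast hν id
  simp only [factorialMoment, Nat.descFactorial_one]
  exact this

lemma a₁_eq (hν : AEMeasurable ν P) :
    a₁ P ν = ((mean P ν : ℝ)⁻¹) ^ 2 * (factorialMoment P ν 2).toReal := by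
  rw [a₁, factorialMoment, ← integral_natCast hν fun k => k.descFactorial 2, inv_pow]
  simp only [Nat.cast_descFactorial_two]

lemma a₂_eq (hν : AEMeasurable ν P) :
    a₂ P ν = ((mean P ν : ℝ)⁻¹) ^ 3 * (factorialMoment P ν 3).toReal := by
  rw [a₂, factorialMoment, ← integral_natCast hν fun k => k.descFactorial 3, inv_pow]
  congr 1
  refine integral_congr_ae (Eventually.of_forall fun ω => ?_)
  simp only
  split_ifs with h2
  · rw [Nat.descFactorial_succ, Nat.cast_mul, Nat.cast_descFactorial_two, Nat.cast_sub h2]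
    push_cast
    ring
  · rw [Nat.descFactorial_eq_zero_iff_lt.2 (by omega), Nat.cast_zero]

lemma coe_mean_ennreal (hν : AEMeasurable ν P) (hfin : factorialMoment P ν 1 ≠ ∞) :
    (mean P ν : ℝ≥0∞) = factorialMoment P ν 1 := by
  rw [← ENNReal.ofReal_coe_nnreal, coe_mean hν, ENNReal.ofReal_toReal hfin]

/-- Since k ≤ 1 + k(k - 1) for every natural k, a vanishing second factorial moment would force the
mean to be at most one. This gives a₁ > 0. -/
lemma factorialMoment_two_ne_zero [IsProbabilityMeasure P]
    (h1 : 1 < factorialMoment P ν 1) : factorialMoment P ν 2 ≠ 0 := by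
  intro h0
  have : factorialMoment P ν 1 ≤ ∫⁻ ω, (1 + ((ν ω).descFactorial 2 : ℝ≥0∞)) ∂P := by
    refine lintegral_mono fun ω => ?_
    have h : ∀ k : ℕ, k.descFactorial 1 ≤ 1 + k.descFactorial 2 := by
      intro k
      rcases k with _ | _ | k
      · simp
      · simp
      · simp
        nlinarith
    calc ((ν ω).descFactorial 1 : ℝ≥0∞) ≤ ((1 + (ν ω).descFactorial 2 : ℕ) : ℝ≥0∞) :=
          Nat.cast_le.2 (h _)
      _ = 1 + ((ν ω).descFactorial 2 : ℝ≥0∞) := by push_cast; rfl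
  rw [lintegral_add_left measurable_const] at this
  simp only [lintegral_const, measure_univ, mul_one] at this
  rw [factorialMoment] at h0
  rw [h0, add_zero] at this
  exact absurd h1 this.not_gt

lemma ae_ne_zero_of_lintegral_inv (hξm : AEMeasurable ξ P)
    (hξ : ∫⁻ ω, (ξ ω : ℝ≥0∞)⁻¹ ∂P ≠ ∞) : ∀ᵐ ω ∂P, ξ ω ≠ 0 := by
  filter_upwards [ae_lt_top' hξm.coe_nnreal_ennreal.inv hξ] with ω hω h0
  simp [h0] at hω

lemma xiMoment_one_ne_zero [IsProbabilityMeasure P] (hξm : AEMeasurable ξ P)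
    (hξ : ∀ᵐ ω ∂P, ξ ω ≠ 0) : xiMoment P ξ 1 ≠ 0 := by
  intro h0
  rw [xiMoment, lintegral_eq_zero_iff' (hξm.coe_nnreal_ennreal.pow_const 1)] at h0
  obtain ⟨ω, h1, h2⟩ := (h0.and hξ).exists
  simp [h2] at h1

variable {N : List ℕ → Ω → ℕ} {Ξ : List ℕ → Ω → ℝ≥0} {m : ℝ≥0}
  (h : IsBranchingNetwork P ν ξ N Ξ) (hm : 0 < m)
  (hD : factorialMoment P ν 1 = m)
include h hm hD

lemma condMoment_succ_one_eq (c : ℝ≥0∞) (n : ℕ) :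
    condMoment P N Ξ m c (n + 1) 1 = edgeMoment P N Ξ m c n 1 := by
  have h1 : (m : ℝ≥0∞) ≠ 0 := by simpa using hm.ne'
  rw [condMoment_succ_one h hm, hD, ← mul_assoc, ENNReal.inv_mul_cancel h1 (by simp), one_mul]

omit h hm hD in
lemma condMoment_zero_right [IsProbabilityMeasure P] (c : ℝ≥0∞) (n : ℕ) : condMoment P N Ξ m c n 0 = 1 := by
  simp [condMoment]

/-- Induction with the tangent bound; the mean conductance is at most that of n + 1 equal conductors
`b` in series. -/
lemma condMoment_one_le_div [IsProbabilityMeasure P] (hξm : AEMeasurable ξ P) {b : ℝ≥0}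
    (hb : ∫⁻ ω, (ξ ω : ℝ≥0∞)⁻¹ ∂P = b) (n : ℕ) :
    condMoment P N Ξ m ⊤ (n + 1) 1 ≤ ((b / (n + 1 : ℕ) : ℝ≥0) : ℝ≥0∞) := by
  induction n with
  | zero =>
    rw [condMoment_succ_one_eq h hm hD]
    refine (edgeMoment_succ_le h 0).trans ?_
    rw [hb, condMoment_zero_right]
    simp
  | succ n ih =>
    rw [condMoment_succ_one_eq h hm hD]
    have hfin : condMoment P N Ξ m ⊤ (n + 1) 1 ≠ ∞ := ne_top_of_le_ne_top ENNReal.coe_ne_top ih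
    -- The voltage drops for conductances `b / (n + 1)` and `b` in series; with these weights the
    -- bound is exactly `b / (n + 2)`.
    refine (edgeMoment_one_le_tangent h hfin
      (ae_ne_zero_of_lintegral_inv hξm (by simp [hb])) (((n : ℝ≥0) + 1) / (n + 2)) (1 / (n + 2))
      ?_).trans ?_
    · field_simp
      ring
    · rw [hb]
      calc _ ≤ ((((n : ℝ≥0) + 1) / (n + 2) : ℝ≥0) : ℝ≥0∞) ^ 2 *
            ((b / (n + 1 : ℕ) : ℝ≥0) : ℝ≥0∞) + ((1 / (n + 2) : ℝ≥0) : ℝ≥0∞) ^ 2 * b := by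
            gcongr
        _ = ((b / (n + 1 + 1 : ℕ) : ℝ≥0) : ℝ≥0∞) := by
          norm_cast
          rw [← NNReal.coe_inj]
          push_cast
          field_simp
          ring

/-- From a finite constant start the mean does not increase, and `hK` makes `K * c ^ 2` an invariant
bound for the second moment, uniformly in `n`. -/
lemma condMoment_two_start_le [IsProbabilityMeasure P] {ρ A K : ℝ≥0} (hρ : (m : ℝ≥0∞)⁻¹ = ρ)
    (hA : (m : ℝ≥0∞)⁻¹ ^ 2 * factorialMoment P ν 2 = A) (hK1 : 1 ≤ K) (hK : ρ * K + A ≤ K)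
    (c : ℝ≥0) (n : ℕ) : condMoment P N Ξ m c n 1 ≤ c ∧ condMoment P N Ξ m c n 2 ≤ K * c ^ 2 := by
  induction n with
  | zero =>
    simp only [condMoment, recCond, lintegral_const, measure_univ, mul_one, pow_one, le_refl,
      true_and]
    exact_mod_cast le_mul_of_one_le_left (by positivity) hK1
  | succ n ih =>
    have h1 : edgeMoment P N Ξ m c n 1 ≤ c := (edgeMoment_le_condMoment 1).trans ih.1
    have h2 : edgeMoment P N Ξ m c n 2 ≤ K * c ^ 2 := (edgeMoment_le_condMoment 2).trans ih.2
    refine ⟨(condMoment_succ_one_eq h hm hD _ _).trans_le h1, ?_⟩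
    have h0 : (m : ℝ≥0∞) ≠ 0 := by simpa using hm.ne'
    have e : condMoment P N Ξ m c (n + 1) 2 =
        ρ * edgeMoment P N Ξ m c n 2 + A * edgeMoment P N Ξ m c n 1 ^ 2 := by
      rw [condMoment_succ_two h hm, hD, ← hρ, ← hA, mul_add, ← mul_assoc, ← mul_assoc, sq,
        mul_assoc (m : ℝ≥0∞)⁻¹ (m : ℝ≥0∞)⁻¹ m, ENNReal.inv_mul_cancel h0 (by simp), mul_one]
    rw [e]
    calc _ ≤ (ρ : ℝ≥0∞) * (K * c ^ 2) + A * c ^ 2 := by gcongr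
      _ = ((ρ * K + A : ℝ≥0) : ℝ≥0∞) * c ^ 2 := by
        push_cast
        ring
      _ ≤ K * c ^ 2 := by
        gcongr

/-- Each generation lowers the mean by at most E[ξ] times the second moment, hence by at most E[ξ] K
c². -/
lemma le_condMoment_start_add [IsProbabilityMeasure P] {ρ A K : ℝ≥0} (hρ : (m : ℝ≥0∞)⁻¹ = ρ)
    (hA : (m : ℝ≥0∞)⁻¹ ^ 2 * factorialMoment P ν 2 = A) (hK1 : 1 ≤ K) (hK : ρ * K + A ≤ K)
    (c : ℝ≥0) (n : ℕ) :
    (c : ℝ≥0∞) ≤ condMoment P N Ξ m c n 1 + n * (xiMoment P ξ 1 * (K * c ^ 2)) := by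
  induction n with
  | zero => simp [condMoment, recCond]
  | succ n ih =>
    obtain ⟨h1, h2⟩ := condMoment_two_start_le h hm hD hρ hA hK1 hK c n
    have h3 := condMoment_one_le h (ne_top_of_le_ne_top ENNReal.coe_ne_top h1)
    rw [← condMoment_succ_one_eq h hm hD] at h3
    calc (c : ℝ≥0∞) ≤ condMoment P N Ξ m c n 1 + n * (xiMoment P ξ 1 * (K * c ^ 2)) := ih
      _ ≤ condMoment P N Ξ m c (n + 1) 1 + xiMoment P ξ 1 * (K * c ^ 2) +
          n * (xiMoment P ξ 1 * (K * c ^ 2)) := by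
        gcongr
        exact h3.trans (by gcongr)
      _ = _ := by
        push_cast
        ring

lemma exists_div_le_condMoment [IsProbabilityMeasure P] (hm1 : 1 < m) (hD2 : factorialMoment P ν 2 ≠ ∞)
    (hb : xiMoment P ξ 1 ≠ ∞) (hb0 : xiMoment P ξ 1 ≠ 0) :
    ∃ δ : ℝ≥0, 0 < δ ∧ ∀ n : ℕ, 1 ≤ n →
      ((δ / n : ℝ≥0) : ℝ≥0∞) ≤ condMoment P N Ξ m ⊤ n 1 := by
  have hρ : (m : ℝ≥0∞)⁻¹ = (m⁻¹ : ℝ≥0) := (ENNReal.coe_inv hm.ne').symm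
  obtain ⟨A, hA⟩ : ∃ A : ℝ≥0, (m : ℝ≥0∞)⁻¹ ^ 2 * factorialMoment P ν 2 = A :=
    ⟨_, (ENNReal.coe_toNNReal (by rw [hρ]; finiteness)).symm⟩
  obtain ⟨b, hb'⟩ : ∃ b : ℝ≥0, xiMoment P ξ 1 = b := ⟨_, (ENNReal.coe_toNNReal hb).symm⟩
  have hbpos : 0 < b := by
    rw [pos_iff_ne_zero]
    rintro rfl
    exact hb0 (by simp [hb'])
  -- Any K ≥ A/(1 - 1/m) satisfies the second condition; adding 1 secures the first.
  obtain ⟨K, hK1, hK⟩ : ∃ K : ℝ≥0, 1 ≤ K ∧ m⁻¹ * K + A ≤ K := by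
    have hm' : (1 : ℝ) < m := by exact_mod_cast hm1
    have h1 : (0 : ℝ) < 1 - (m : ℝ)⁻¹ := sub_pos.2 (inv_lt_one_of_one_lt₀ hm')
    have h2 : (0 : ℝ) ≤ A / (1 - (m : ℝ)⁻¹) := div_nonneg A.coe_nonneg h1.le
    refine ⟨Real.toNNReal (1 + A / (1 - (m : ℝ)⁻¹)), ?_, ?_⟩
    · rw [← NNReal.coe_le_coe, Real.coe_toNNReal _ (by linarith)]
      simpa using h2
    · rw [← NNReal.coe_le_coe]
      push_cast
      rw [Real.coe_toNNReal _ (by linarith)]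
      have h3 : A / (1 - (m : ℝ)⁻¹) * (1 - (m : ℝ)⁻¹) = A := div_mul_cancel₀ _ h1.ne'
      nlinarith
  have hKpos : 0 < K := lt_of_lt_of_le one_pos hK1
  refine ⟨1 / (4 * b * K), by positivity, fun n hn => ?_⟩
  have hn' : (0 : ℝ≥0) < n := by exact_mod_cast hn
  -- The maximiser of c - n b K c², whose maximum is c/2 = 1/(4bKn). Lowering the start from `⊤` to
  -- `c` only decreases the conductance.
  set c : ℝ≥0 := 1 / (2 * b * K * n) with hc
  have key := le_condMoment_start_add h hm hD hρ hA hK1 hK c n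
  have hmono : condMoment P N Ξ m c n 1 ≤ condMoment P N Ξ m ⊤ n 1 :=
    lintegral_mono fun ω => pow_le_pow_left' (recCond_mono m le_top n _ _) 1
  refine le_trans ?_ hmono
  have e : (n : ℝ≥0∞) * (xiMoment P ξ 1 * (K * c ^ 2)) =
      ((1 / (4 * b * K) / n : ℝ≥0) : ℝ≥0∞) := by
    rw [hb']
    norm_cast
    rw [hc]
    field_simp
    norm_num
  have e' : (c : ℝ≥0∞) = ((1 / (4 * b * K) / n : ℝ≥0) : ℝ≥0∞) +
      ((1 / (4 * b * K) / n : ℝ≥0) : ℝ≥0∞) := by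
    norm_cast
    rw [hc]
    field_simp
    norm_num
  rw [e] at key
  refine (ENNReal.add_le_add_iff_right (a := ((1 / (4 * b * K) / n : ℝ≥0) : ℝ≥0∞))
    ENNReal.coe_ne_top).1 ?_
  rwa [← e']

end Bounds

/-! ### The moments of the conductances satisfy the moment recursion -/

/-- Only the order of magnitude of the fourth moment matters, so the forcing coefficients are merged
into one constant; the contraction factor `m⁻¹ ^ 3` is kept exact. -/
lemma fourth_moment_bound {m d₂ d₃ d₄ p q t v w : ℝ} (hm : 0 < m) (hd₂ : 0 ≤ d₂) (hd₃ : 0 ≤ d₃)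
    (hd₄ : 0 ≤ d₄) (hp : 0 ≤ p) (hq : 0 ≤ q) (ht : 0 ≤ t) (hvw : v ≤ w) :
    m⁻¹ ^ 4 * (m * v + d₂ * (4 * (t * p) + 3 * q ^ 2) + d₃ * (6 * (q * p ^ 2)) + d₄ * p ^ 4) ≤
      m⁻¹ ^ 3 * w +
        m⁻¹ ^ 4 * (4 * d₂ + 6 * d₃ + d₄) * (t * p + q ^ 2 + q * p ^ 2 + p ^ 4) := by
  have h1 : m⁻¹ ^ 3 * w = m⁻¹ ^ 4 * (m * w) := by
    field_simp
  have h2 : d₂ * (4 * (t * p) + 3 * q ^ 2) + d₃ * (6 * (q * p ^ 2)) + d₄ * p ^ 4 ≤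
      (4 * d₂ + 6 * d₃ + d₄) * (t * p + q ^ 2 + q * p ^ 2 + p ^ 4) := by
    rw [← sub_nonneg]
    have : (4 * d₂ + 6 * d₃ + d₄) * (t * p + q ^ 2 + q * p ^ 2 + p ^ 4) -
        (d₂ * (4 * (t * p) + 3 * q ^ 2) + d₃ * (6 * (q * p ^ 2)) + d₄ * p ^ 4) =
        d₂ * (q ^ 2 + 4 * (q * p ^ 2) + 4 * p ^ 4) + 6 * d₃ * (t * p + q ^ 2 + p ^ 4) +
          d₄ * (t * p + q ^ 2 + q * p ^ 2) := by ring
    rw [this]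
    positivity
  rw [h1, mul_assoc (m⁻¹ ^ 4), ← mul_add, add_assoc, add_assoc, ← add_assoc (d₂ * _)]
  gcongr

section Recursion

variable {Ω : Type*} [MeasurableSpace Ω] {P : Measure Ω} {ν : Ω → ℕ} {ξ : Ω → ℝ≥0}
  {N : List ℕ → Ω → ℕ} {Ξ : List ℕ → Ω → ℝ≥0} {m : ℝ≥0}
  (h : IsBranchingNetwork P ν ξ N Ξ) (hm : 0 < m)
include h

lemma edgeMoment_succ_ne_top {c : ℝ≥0∞} {n j : ℕ} (hξ : ∫⁻ ω, (ξ ω : ℝ≥0∞)⁻¹ ∂P ≠ ∞)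
    (hM : condMoment P N Ξ m c n j ≠ ∞) : edgeMoment P N Ξ m c n (j + 1) ≠ ∞ :=
  ne_top_of_le_ne_top (ENNReal.mul_ne_top hξ hM) (edgeMoment_succ_le h j)

include hm

/-- Each generation gains one finite moment through `edgeMoment_succ_le`, so the moment of order `j`
is finite from level `j` on, even from the start `⊤`. -/
lemma condMoment_ne_top [IsProbabilityMeasure P] (hD : ∀ j ≤ 4, factorialMoment P ν j ≠ ∞)
    (hξ : ∫⁻ ω, (ξ ω : ℝ≥0∞)⁻¹ ∂P ≠ ∞) (c : ℝ≥0∞) {j : ℕ} (hj : j ≤ 4) {n : ℕ} (hn : j ≤ n) :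
    condMoment P N Ξ m c n j ≠ ∞ := by
  have hm0 : (m : ℝ≥0∞)⁻¹ ≠ ∞ := ENNReal.inv_ne_top.2 (by simpa using hm.ne')
  have hD1 := hD 1 (by norm_num)
  have hD2 := hD 2 (by norm_num)
  have hD3 := hD 3 (by norm_num)
  have hD4 := hD 4 (by norm_num)
  induction j using Nat.strong_induction_on generalizing n with
  | _ j ih =>
    rcases n with _ | n
    · obtain rfl : j = 0 := by omega
      simp [condMoment_zero_right]
    have hQ : ∀ i < j, edgeMoment P N Ξ m c n (i + 1) ≠ ∞ := fun i hi =>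
      edgeMoment_succ_ne_top h hξ (ih i hi (by omega) (by omega))
    interval_cases j
    · simp [condMoment_zero_right]
    · have h1 := hQ 0 (by norm_num)
      rw [condMoment_succ_one h hm]
      finiteness
    · have h1 := hQ 0 (by norm_num)
      have h2 := hQ 1 (by norm_num)
      rw [condMoment_succ_two h hm]
      finiteness
    · have h1 := hQ 0 (by norm_num)
      have h2 := hQ 1 (by norm_num)
      have h3 := hQ 2 (by norm_num)
      rw [condMoment_succ_three h hm]
      finiteness
    · have h1 := hQ 0 (by norm_num)
      have h2 := hQ 1 (by norm_num)
      have h3 := hQ 2 (by norm_num)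
      have h4 := hQ 3 (by norm_num)
      rw [condMoment_succ_four h hm]
      finiteness

lemma momentRecursion [IsProbabilityMeasure P] (hD : ∀ j ≤ 4, factorialMoment P ν j ≠ ∞)
    (hD1 : factorialMoment P ν 1 = m) (hξ : ∫⁻ ω, (ξ ω : ℝ≥0∞)⁻¹ ∂P ≠ ∞)
    (hb : ∀ j ≤ 3, xiMoment P ξ j ≠ ∞) :
    MomentRecursion (m : ℝ)⁻¹ ((m : ℝ)⁻¹ ^ 2 * (factorialMoment P ν 2).toReal)
      ((m : ℝ)⁻¹ ^ 3 * (factorialMoment P ν 3).toReal) (xiMoment P ξ 1).toReal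
      (xiMoment P ξ 2).toReal (xiMoment P ξ 3).toReal
      ((m : ℝ)⁻¹ ^ 4 * (4 * (factorialMoment P ν 2).toReal + 6 * (factorialMoment P ν 3).toReal +
        (factorialMoment P ν 4).toReal))
      (fun n => (condMoment P N Ξ m ⊤ n 1).toReal) (fun n => (condMoment P N Ξ m ⊤ n 2).toReal)
      (fun n => (condMoment P N Ξ m ⊤ n 3).toReal) (fun n => (condMoment P N Ξ m ⊤ n 4).toReal)
      (fun n => (edgeMoment P N Ξ m ⊤ n 2).toReal)
      (fun n => (edgeMoment P N Ξ m ⊤ n 3).toReal) := by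
  have hm0 : (m : ℝ≥0∞)⁻¹ ≠ ∞ := ENNReal.inv_ne_top.2 (by simpa using hm.ne')
  have hmr : (0 : ℝ) < m := NNReal.coe_pos.2 hm
  have d2 := hD 2 (by norm_num)
  have d3 := hD 3 (by norm_num)
  have d4 := hD 4 (by norm_num)
  have e1 := hb 1 (by norm_num)
  have e2 := hb 2 (by norm_num)
  have e3 := hb 3 (by norm_num)
  have hM : ∀ j ≤ 4, ∀ n ≥ 4, condMoment P N Ξ m ⊤ n j ≠ ∞ := fun j hj n hn =>
    condMoment_ne_top h hm hD hξ ⊤ hj (hj.trans hn)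
  have hQ : ∀ j ≤ 4, ∀ n ≥ 4, edgeMoment P N Ξ m ⊤ n j ≠ ∞ := fun j hj n hn =>
    ne_top_of_le_ne_top (hM j hj n hn) (edgeMoment_le_condMoment j)
  -- From level 4 on all four moments are finite, so `toReal` respects sums and inequalities; this
  -- is why the recursion is required only eventually.
  have h4 : ∀ᶠ n : ℕ in atTop, 4 ≤ n := eventually_ge_atTop 4
  have hM1 := hM 1 (by norm_num)
  have hM2 := hM 2 (by norm_num)
  have hM3 := hM 3 (by norm_num)
  have hM4 := hM 4 (by norm_num)
  have hQ1 := hQ 1 (by norm_num)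
  have hQ2 := hQ 2 (by norm_num)
  have hQ3 := hQ 3 (by norm_num)
  have hQ4 := hQ 4 (by norm_num)
  refine ⟨fun n => ENNReal.toReal_nonneg, fun n => ENNReal.toReal_nonneg,
    fun n => ENNReal.toReal_nonneg, fun n => ENNReal.toReal_nonneg,
    fun n => ENNReal.toReal_nonneg, fun n => ENNReal.toReal_nonneg, ?_, ?_, ?_, ?_, ?_, ?_, ?_,
    ?_, ?_, ?_⟩
  all_goals filter_upwards [h4] with n hn
  all_goals
    have hM1 := hM1 n hn
    have hM2 := hM2 n hn
    have hM3 := hM3 n hn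
    have hM4 := hM4 n hn
    have hQ1 := hQ1 n hn
    have hQ2 := hQ2 n hn
    have hQ3 := hQ3 n hn
    have hQ4 := hQ4 n hn
    have hx := condMoment_succ_one_eq h hm hD1 ⊤ n
  · rw [hx, condMoment_succ_two h hm, hD1, ENNReal.toReal_mul,
      ENNReal.toReal_add (by finiteness) (by finiteness)]
    simp only [ENNReal.toReal_mul, ENNReal.toReal_pow, ENNReal.toReal_inv, ENNReal.coe_toReal]
    field_simp
  · rw [hx, condMoment_succ_three h hm, hD1, ENNReal.toReal_mul,
      ENNReal.toReal_add (by finiteness) (by finiteness),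
      ENNReal.toReal_add (by finiteness) (by finiteness)]
    simp only [ENNReal.toReal_mul, ENNReal.toReal_pow, ENNReal.toReal_inv, ENNReal.coe_toReal,
      ENNReal.toReal_ofNat]
    field_simp
  · rw [hx, condMoment_succ_four h hm, hD1, ENNReal.toReal_mul,
      ENNReal.toReal_add (by finiteness) (by finiteness),
      ENNReal.toReal_add (by finiteness) (by finiteness),
      ENNReal.toReal_add (by finiteness) (by finiteness), ENNReal.toReal_mul (b := _ + _),
      ENNReal.toReal_add (by finiteness) (by finiteness)]
    have hw := ENNReal.toReal_mono hM4 (edgeMoment_le_condMoment (m := m) (c := ⊤) (n := n)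
      (P := P) (N := N) (Ξ := Ξ) 4)
    simp only [ENNReal.toReal_mul, ENNReal.toReal_pow, ENNReal.toReal_inv, ENNReal.coe_toReal,
      ENNReal.toReal_ofNat]
    exact fourth_moment_bound hmr ENNReal.toReal_nonneg ENNReal.toReal_nonneg
      ENNReal.toReal_nonneg ENNReal.toReal_nonneg ENNReal.toReal_nonneg ENNReal.toReal_nonneg hw
  · rw [hx]
    have := ENNReal.toReal_mono (by finiteness) (edgeMoment_one_add_le h hM1)
    rw [ENNReal.toReal_add (by finiteness) (by finiteness),
      ENNReal.toReal_add (by finiteness) (by finiteness)] at this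
    simpa only [ENNReal.toReal_mul] using this
  · rw [hx]
    have := ENNReal.toReal_mono (by finiteness) (le_edgeMoment_one_add h hM1)
    rw [ENNReal.toReal_add (by finiteness) (by finiteness),
      ENNReal.toReal_add (by finiteness) (by finiteness),
      ENNReal.toReal_add (by finiteness) (by finiteness)] at this
    simpa only [ENNReal.toReal_mul] using this
  · exact ENNReal.toReal_mono hM2 (edgeMoment_le_condMoment 2)
  · have := ENNReal.toReal_mono (by finiteness) (edgeMoment_two_add_le h hM1)
    rw [ENNReal.toReal_add (by finiteness) (by finiteness),
      ENNReal.toReal_add (by finiteness) (by finiteness)] at this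
    simpa only [ENNReal.toReal_mul, ENNReal.toReal_ofNat] using this
  · have := ENNReal.toReal_mono (by finiteness) (condMoment_two_le h hM1)
    rw [ENNReal.toReal_add (by finiteness) (by finiteness)] at this
    simpa only [ENNReal.toReal_mul, ENNReal.toReal_ofNat] using this
  · exact ENNReal.toReal_mono hM3 (edgeMoment_le_condMoment 3)
  · have := ENNReal.toReal_mono (by finiteness) (condMoment_three_le h hM1)
    rw [ENNReal.toReal_add (by finiteness) (by finiteness)] at this
    simpa only [ENNReal.toReal_mul, ENNReal.toReal_ofNat] using this

end Recursion

/-! ### The expected conductance -/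

section Main

variable {Ω : Type*} [MeasurableSpace Ω] {P : Measure Ω} {ν : Ω → ℕ} {ξ : Ω → ℝ≥0}
  {N : List ℕ → Ω → ℕ} {Ξ : List ℕ → Ω → ℝ≥0} {m : ℝ≥0}

/-- There are countably many words, so almost surely all offspring numbers and edge variables are
nonzero at once and the deterministic identity applies. -/
lemma conductance_ae_eq (h : IsBranchingNetwork P ν ξ N Ξ) (hm : 0 < m)
    (hν : ∀ᵐ ω ∂P, ν ω ≠ 0) (hξ : ∀ᵐ ω ∂P, ξ ω ≠ 0) {n : ℕ} (hn : 1 ≤ n) :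
    conductance m N Ξ n =ᵐ[P] fun ω => recCond m ⊤ n (fun u => N u ω) (fun u => Ξ u ω) := by
  have hN : ∀ᵐ ω ∂P, ∀ u, N u ω ≠ 0 := ae_all_iff.2 fun u =>
    (h.identDistrib_offspring u).symm.ae_snd (p := fun a => a ≠ 0)
      (measurableSet_singleton (0 : ℕ)).compl hν
  have hΞ : ∀ᵐ ω ∂P, ∀ u, Ξ u ω ≠ 0 := ae_all_iff.2 fun u =>
    (h.identDistrib_edge u).symm.ae_snd (p := fun a => a ≠ 0)
      (measurableSet_singleton (0 : ℝ≥0)).compl hξ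
  obtain ⟨n, rfl⟩ := Nat.exists_eq_add_of_le' hn
  filter_upwards [hN, hΞ] with ω h1 h2
  exact effectiveConductance_eq_recCond hm (fun u => Nat.one_le_iff_ne_zero.2 (h1 u))
    (fun u => pos_iff_ne_zero.2 (h2 u)) n

end Main

end BranchingNetwork

theorem theorem3 {Ω : Type*} [MeasurableSpace Ω] (P : Measure Ω) [IsProbabilityMeasure P]
    (ν : Ω → ℕ) (ξ : Ω → ℝ≥0) (N : List ℕ → Ω → ℕ) (Ξ : List ℕ → Ω → ℝ≥0)
    (hnet : IsBranchingNetwork P ν ξ N Ξ)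
    (hp₀ : P {ω | ν ω = 0} = 0)
    (hm : 1 < mean P ν)
    (hmom : ∫⁻ ω, ((ξ ω : ℝ≥0∞) ^ 3 + (ξ ω : ℝ≥0∞)⁻¹ + (ν ω : ℝ≥0∞) ^ 4) ∂P < ∞) :
    (∀ n : ℕ, 1 ≤ n →
      AEMeasurable (conductance (mean P ν) N Ξ n) P ∧
        ∫⁻ ω, conductance (mean P ν) N Ξ n ω ∂P < ∞) ∧
    ∃ c₀ : ℝ,
      (fun n : ℕ =>
        (∫⁻ ω, conductance (mean P ν) N Ξ n ω ∂P).toReal -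
          (1 / (c₁ P ν ξ * n)
            - c₄ P ν ξ / c₁ P ν ξ ^ 2 * (Real.log n / (n : ℝ) ^ 2)
            - c₀ / c₁ P ν ξ ^ 2 * (1 / (n : ℝ) ^ 2)))
        =O[atTop] fun n : ℕ => Real.log n ^ 2 / (n : ℝ) ^ 3 := by
  have hνm : AEMeasurable ν P := (hnet.identDistrib_offspring []).aemeasurable_snd
  have hξm : AEMeasurable ξ P := (hnet.identDistrib_edge []).aemeasurable_snd
  have hξ3 : ∫⁻ ω, (ξ ω : ℝ≥0∞) ^ 3 ∂P ≠ ∞ := ne_top_of_le_ne_top hmom.ne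
    (lintegral_mono fun ω => le_self_add.trans le_self_add)
  have hξi : ∫⁻ ω, (ξ ω : ℝ≥0∞)⁻¹ ∂P ≠ ∞ := ne_top_of_le_ne_top hmom.ne
    (lintegral_mono fun ω => le_add_self.trans le_self_add)
  have hν4 : ∫⁻ ω, (ν ω : ℝ≥0∞) ^ 4 ∂P ≠ ∞ := ne_top_of_le_ne_top hmom.ne
    (lintegral_mono fun ω => le_add_self)
  have hD : ∀ j ≤ 4, factorialMoment P ν j ≠ ∞ := fun j hj => factorialMoment_ne_top hν4 hj
  have hb : ∀ j ≤ 3, xiMoment P ξ j ≠ ∞ := fun j hj => xiMoment_ne_top hξ3 hj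
  have hD1 := (coe_mean_ennreal hνm (hD 1 (by norm_num))).symm
  have ha₁ := a₁_eq hνm
  have ha₂ := a₂_eq hνm
  have hc₁ : c₁ P ν ξ = a₁ P ν * b₁ P ξ / (1 - (mean P ν : ℝ)⁻¹) := rfl
  have hc₂ : c₂ P ν = (1 - ((mean P ν : ℝ) ^ 2)⁻¹)⁻¹ *
    (3 * a₁ P ν ^ 2 / ((mean P ν : ℝ) - 1) + a₂ P ν) := rfl
  have hc₃ : c₃ P ν ξ = 2 * a₁ P ν * c₁ P ν ξ / ((mean P ν : ℝ) - 1) -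
    2 * b₁ P ξ * c₂ P ν / (mean P ν : ℝ) := rfl
  have hc₄ : c₄ P ν ξ = b₁ P ξ / (1 - (mean P ν : ℝ)⁻¹) * (c₃ P ν ξ / c₁ P ν ξ + a₁ P ν)
    - b₂ P ξ * (c₂ P ν / c₁ P ν ξ) := rfl
  set m := mean P ν with hmdef
  have hm0 : 0 < m := one_pos.trans hm
  have hmr : (1 : ℝ) < m := by exact_mod_cast hm
  have hρ0 : (0 : ℝ) < (m : ℝ)⁻¹ := by positivity
  have hρ1 : (m : ℝ)⁻¹ < 1 := inv_lt_one_of_one_lt₀ hmr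
  have hξ0 := ae_ne_zero_of_lintegral_inv hξm hξi
  have hν0 : ∀ᵐ ω ∂P, ν ω ≠ 0 := by
    rw [ae_iff]
    simpa using hp₀
  have hae := fun (n : ℕ) (hn : 1 ≤ n) => conductance_ae_eq hnet hm0 hν0 hξ0 hn
  have hint : ∀ n, 1 ≤ n → ∫⁻ ω, conductance m N Ξ n ω ∂P = condMoment P N Ξ m ⊤ n 1 :=
    fun n hn => (lintegral_congr_ae (hae n hn)).trans lintegral_recCond
  refine ⟨fun n hn => ⟨⟨_, measurable_recCond_network hnet m ⊤ n, hae n hn⟩, ?_⟩, ?_⟩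
  · rw [hint n hn]
    exact (condMoment_ne_top hnet hm0 hD hξi ⊤ (by norm_num) hn).lt_top
  have hrec := momentRecursion hnet hm0 hD hD1 hξi hb
  rw [← ha₁, ← ha₂, ← b₁_eq hξm, ← b₂_eq hξm] at hrec
  have ha₁pos : 0 < a₁ P ν := by
    rw [ha₁]
    have h2 : factorialMoment P ν 2 ≠ 0 := factorialMoment_two_ne_zero (by
      rw [hD1]
      exact_mod_cast hm)
    have := ENNReal.toReal_pos h2 (hD 2 (by norm_num))
    positivity
  have hb₁pos : 0 < b₁ P ξ := by
    rw [b₁_eq hξm]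
    exact ENNReal.toReal_pos (xiMoment_one_ne_zero hξm hξ0) (hb 1 (by norm_num))
  have hdecay : DecayO 1 fun n => (condMoment P N Ξ m ⊤ n 1).toReal := by
    obtain ⟨b, hb'⟩ : ∃ b : ℝ≥0, ∫⁻ ω, (ξ ω : ℝ≥0∞)⁻¹ ∂P = b :=
      ⟨_, (ENNReal.coe_toNNReal hξi).symm⟩
    refine IsBigO.of_bound b ?_
    filter_upwards [eventually_ge_atTop 1] with n hn
    obtain ⟨n, rfl⟩ := Nat.exists_eq_add_of_le' hn
    have h1 := ENNReal.toReal_mono ENNReal.coe_ne_top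
      (condMoment_one_le_div hnet hm0 hD1 hξm hb' n)
    rw [Real.norm_of_nonneg ENNReal.toReal_nonneg, Real.norm_of_nonneg (by positivity), pow_one,
      ← div_eq_mul_inv]
    exact h1
  obtain ⟨δ, hδ, hlow⟩ := exists_div_le_condMoment hnet hm0 hD1 hm (hD 2 (by norm_num))
    (hb 1 (by norm_num)) (xiMoment_one_ne_zero hξm hξ0)
  have hlow' : ∀ᶠ n : ℕ in atTop, (δ : ℝ) / n ≤ (condMoment P N Ξ m ⊤ n 1).toReal := by
    filter_upwards [eventually_ge_atTop 1] with n hn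
    have := ENNReal.toReal_mono (condMoment_ne_top hnet hm0 hD hξi ⊤ (by norm_num) hn)
      (hlow n hn)
    simpa using this
  have hρ' : (0 : ℝ) < 1 - (m : ℝ)⁻¹ := sub_pos.2 hρ1
  have hρ2 : (0 : ℝ) < 1 - (m : ℝ)⁻¹ ^ 2 := by nlinarith
  have hm1 : (0 : ℝ) < (m : ℝ) - 1 := by linarith
  have hmpos : (0 : ℝ) < m := by linarith
  have hc : b₁ P ξ * (a₁ P ν / (1 - (m : ℝ)⁻¹)) = c₁ P ν ξ := by
    rw [hc₁]
    ring
  have hcpos : 0 < c₁ P ν ξ := by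
    rw [hc₁]
    positivity
  -- Translates the factors ρ/(1 - ρ) from the fixed-point equations into the 1/(m - 1) of c₂ and
  -- c₃.
  have hmm : (m : ℝ)⁻¹ / (1 - (m : ℝ)⁻¹) = 1 / ((m : ℝ) - 1) := by
    field_simp
  obtain ⟨c₀, hc₀⟩ := hrec.exists_expansion hρ0 hρ1 hdecay (α := a₁ P ν / (1 - (m : ℝ)⁻¹))
    (β := c₂ P ν) (γ := c₃ P ν ξ / (1 - (m : ℝ)⁻¹)) (δ := δ) (div_mul_cancel₀ _ hρ'.ne')
    (by
      rw [hc₂, inv_pow]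
      rw [inv_pow] at hρ2
      rw [mul_comm, ← mul_assoc, mul_inv_cancel₀ hρ2.ne', one_mul]
      congr 1
      calc 3 * a₁ P ν ^ 2 / ((m : ℝ) - 1) = 3 * a₁ P ν ^ 2 * (1 / ((m : ℝ) - 1)) := by ring
        _ = _ := by
          rw [← hmm]
          ring)
    (by
      rw [div_mul_cancel₀ _ hρ'.ne', hc, hc₃]
      congr 1
      · calc 2 * a₁ P ν * c₁ P ν ξ / ((m : ℝ) - 1) =
            2 * a₁ P ν * c₁ P ν ξ * (1 / ((m : ℝ) - 1)) := by ring
          _ = _ := by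
            rw [← hmm]
            ring
      · ring)
    (NNReal.coe_pos.2 hδ) hlow' (by rwa [hc])
  refine ⟨c₀, ?_⟩
  rw [hc] at hc₀
  -- The coefficient l/c₁ of log n in 1/x is c₄, because c₁² / c₁ = c₁ = a₁b₁/(1 - 1/m).
  have hc₄' : (b₁ P ξ * (c₃ P ν ξ / (1 - (m : ℝ)⁻¹)) - b₂ P ξ * c₂ P ν + c₁ P ν ξ ^ 2) /
      c₁ P ν ξ = c₄ P ν ξ := by
    rw [hc₄, add_div, sub_div, sq, mul_div_assoc (c₁ P ν ξ), div_self hcpos.ne', mul_one,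
      ← hc]
    ring
  rw [hc₄'] at hc₀
  refine hc₀.congr' ?_ EventuallyEq.rfl
  filter_upwards [eventually_ge_atTop 1] with n hn
  rw [hint n hn]
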